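/- Consider a one-armed bandit with discount factor $\beta\in(0,1)$. In each round $t=0,1,2,\dots$ each of two players, Alice and Bob, pulls the left arm $L$ or the right arm $R$ and receives a reward in $\{0,1\}$. A pull of $L$ succeeds with known probability $p\in[0,1]$. A pull of $R$ succeeds with an unknown probability $\theta$, drawn once before play from a known prior $\mu$ on $[0,1]$ that is not a point mass; given $\theta$, all rewards are independent. After each round a player observes the own reward and the arm chosen by the other player, but not the other's reward. A pure strategy maps the past actions of both players and the past own rewards to an arm; a (mixed) strategy is a probability distribution over pure strategies, and the two players randomize independently. The total reward of player $i$ is $\Gamma_i=\sum_{t\ge 0}\beta^t\gamma_i(t)$, where $\gamma_i(t)$ is the reward of $i$ in round $t$. The players cooperate: both have utility $\Gamma_A+\Gamma_B$, and a strategy pair is optimal if it maximizes $\mathbb{E}(\Gamma_A+\Gamma_B)$ over all strategy pairs. A player explores if that player pulls $R$ at least once. Let $g=g(\mu,\beta)$ be the Gittins index of $R$, the infimum of the $p\in[0,1]$ for which always playing $L$ is optimal for a single player (one who plays alone and maximizes the own expected total discounted reward), and let $w>0$ be the variance of $\mu$. Put $\widehat p = g+\beta^2 w(1-\beta)/4$.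 Then $\widehat p>g$, and for every $p\in[0,1]$ with $p<\widehat p$, under every optimal strategy pair at least one of the two players explores with positive probability. In contrast, for every $p\in(g,1]$, under every optimal strategy of a single player that player explores with probability $0$; in this sense cooperating players explore more than a single player. -/

import Mathlib

open MeasureTheory ProbabilityTheory

noncomputable section

namespace Bandit

/-- The two arms: `L` is the predictable left arm, `R` is the risky right arm. -/
inductive Arm : Type
  | L
  | R

/-- The two players. -/
inductive Player : Type
  | alice
  | bob

instance : MeasurableSpace Arm := ⊤

instance : MeasurableSpace Player := ⊤

/-- Success probability of an arm: `p` for the left arm, `θ` for the right arm. -/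
def successProb (p θ : ℝ) : Arm → ℝ
  | Arm.L => p
  | Arm.R => θ

/-- The bit produced by a pull of arm `a`, where `u` is a uniform random number in `[0,1]`:
a success with probability `successProb p θ a`. -/
def rewardBit (p θ : ℝ) (u : unitInterval) (a : Arm) : Bool :=
  open scoped Classical in decide ((u : ℝ) < successProb p θ a)

/-- Discounted sum of a sequence of bits. -/
def discountedSum (β : ℝ) (x : ℕ → Bool) : ℝ :=
  ∑' t : ℕ, β ^ t * (if x t then 1 else 0)

/-! ### The game with a single player -/

/-- A pure strategy of a single player: the arm to pull in round `t`, given the own actions and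
the observed bits of the rounds before `t`. -/
abbrev SinglePure : Type :=
  (t : ℕ) → (Fin t → Arm) → (Fin t → Bool) → Arm

/-- The randomness of Nature for a single player: the success probability of the right arm, and
one uniform number for each round and arm. -/
abbrev SingleNature : Type := unitInterval × (ℕ × Arm → unitInterval)

/-- The success probability of the right arm has law `μ`; given it, all pulls are independent. -/
def singleNatureLaw (μ : Measure unitInterval) : Measure SingleNature :=
  μ.prod (Measure.infinitePi fun _ : ℕ × Arm => (volume : Measure unitInterval))

/-- The arm pulled in round `t` by a single player. -/
def singleAction (p : ℝ) (S : SinglePure) (ω : SingleNature) (t : ℕ) : Arm :=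
  S t (fun s : Fin t => singleAction p S ω s)
    (fun s : Fin t =>
      rewardBit p ω.1 (ω.2 ((s : ℕ), singleAction p S ω s)) (singleAction p S ω s))
termination_by t
decreasing_by all_goals exact s.isLt

/-- The reward of a single player in round `t`. -/
def singleReward (p : ℝ) (S : SinglePure) (ω : SingleNature) (t : ℕ) : Bool :=
  rewardBit p ω.1 (ω.2 (t, singleAction p S ω t)) (singleAction p S ω t)

/-- Expected total discounted reward of a single player with mixed strategy `σ`. -/
def singleValue (μ : Measure unitInterval) (β p : ℝ) (σ : ProbabilityMeasure SinglePure) : ℝ :=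
  ∫ x : SinglePure × SingleNature, discountedSum β (singleReward p x.1 x.2)
    ∂((σ : Measure SinglePure).prod (singleNatureLaw μ))

/-- The mixed strategy `σ` is optimal for a single player. -/
def IsOptimalSingle (μ : Measure unitInterval) (β p : ℝ) (σ : ProbabilityMeasure SinglePure) :
    Prop :=
  ∀ τ : ProbabilityMeasure SinglePure, singleValue μ β p τ ≤ singleValue μ β p σ

/-- The strategy of playing left in every round. -/
def alwaysLeft : ProbabilityMeasure SinglePure :=
  ⟨Measure.dirac (fun _ _ _ => Arm.L), inferInstance⟩

/-- The Gittins index of the right arm: the infimum of the success probabilities `p` of the left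
arm for which playing always left is optimal for a single player. -/
def gittinsIndex (μ : Measure unitInterval) (β : ℝ) : ℝ :=
  sInf {p : ℝ | p ∈ Set.Icc (0 : ℝ) 1 ∧ IsOptimalSingle μ β p alwaysLeft}

/-- Probability that a single player with mixed strategy `σ` pulls the right arm at least once. -/
def singleExploreProb (μ : Measure unitInterval) (p : ℝ) (σ : ProbabilityMeasure SinglePure) :
    ENNReal :=
  ((σ : Measure SinglePure).prod (singleNatureLaw μ))
    {x | ∃ t : ℕ, singleAction p x.1 x.2 t = Arm.R}

/-! ### The game with two players -/

/-- A pure strategy of one of the two players: the arm to pull in round `t`, given the public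
history (the actions of Alice and of Bob in the rounds before `t`) and the private history (the
bits that the player observed in the rounds before `t`). -/
abbrev PureStrategy : Type :=
  (t : ℕ) → (Fin t → Arm × Arm) → (Fin t → Bool) → Arm

/-- A mixed strategy is a probability distribution over pure strategies. -/
abbrev MixedStrategy : Type := ProbabilityMeasure PureStrategy

/-- The randomness of Nature: the success probability of the right arm, and one uniform number
for each round, player and arm. -/
abbrev Nature : Type := unitInterval × (ℕ × Player × Arm → unitInterval)

/-- The success probability of the right arm has law `μ`; given it, all pulls (also those of the
two players in the same round) are independent. -/
def natureLaw (μ : Measure unitInterval) : Measure Nature :=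
  μ.prod (Measure.infinitePi fun _ : ℕ × Player × Arm => (volume : Measure unitInterval))

/-- The pair (Alice's arm, Bob's arm) pulled in round `t`. -/
def actions (p : ℝ) (SA SB : PureStrategy) (ω : Nature) (t : ℕ) : Arm × Arm :=
  (SA t (fun s : Fin t => actions p SA SB ω s)
      (fun s : Fin t =>
        rewardBit p ω.1 (ω.2 ((s : ℕ), Player.alice, (actions p SA SB ω s).1))
          (actions p SA SB ω s).1),
    SB t (fun s : Fin t => actions p SA SB ω s)
      (fun s : Fin t =>
        rewardBit p ω.1 (ω.2 ((s : ℕ), Player.bob, (actions p SA SB ω s).2))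
          (actions p SA SB ω s).2))
termination_by t
decreasing_by all_goals exact s.isLt

/-- The arm pulled by player `i` in round `t`. -/
def action (p : ℝ) (SA SB : PureStrategy) (ω : Nature) (i : Player) (t : ℕ) : Arm :=
  match i with
  | Player.alice => (actions p SA SB ω t).1
  | Player.bob => (actions p SA SB ω t).2

/-- The reward of player `i` in round `t`. -/
def reward (p : ℝ) (SA SB : PureStrategy) (ω : Nature) (i : Player) (t : ℕ) : Bool :=
  rewardBit p ω.1 (ω.2 (t, i, action p SA SB ω i t)) (action p SA SB ω i t)

/-- The total discounted reward of player `i`. -/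
def totalReward (β p : ℝ) (SA SB : PureStrategy) (ω : Nature) (i : Player) : ℝ :=
  discountedSum β (reward p SA SB ω i)

/-- The joint law of Alice's pure strategy, Bob's pure strategy (drawn independently) and
Nature. -/
def gameLaw (μ : Measure unitInterval) (σA σB : MixedStrategy) :
    Measure (PureStrategy × PureStrategy × Nature) :=
  (σA : Measure PureStrategy).prod ((σB : Measure PureStrategy).prod (natureLaw μ))

/-- The utility of player `i` with cooperation parameter `lam`: the own total reward plus `lam`
times the total reward of the other player. -/
def utility (lam β p : ℝ) (SA SB : PureStrategy) (ω : Nature) : Player → ℝ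
  | Player.alice => totalReward β p SA SB ω Player.alice + lam * totalReward β p SA SB ω Player.bob
  | Player.bob => totalReward β p SA SB ω Player.bob + lam * totalReward β p SA SB ω Player.alice

/-- The expected utility of player `i` under the mixed strategies `σA` and `σB`. -/
def expectedUtility (μ : Measure unitInterval) (lam β p : ℝ) (σA σB : MixedStrategy)
    (i : Player) : ℝ :=
  ∫ x : PureStrategy × PureStrategy × Nature, utility lam β p x.1 x.2.1 x.2.2 i
    ∂(gameLaw μ σA σB)

/-- The pair `(σA, σB)` is optimal for cooperating players (`lam = 1`): it maximizes the common
utility of the two players, which is the sum of their total rewards, over all strategy pairs. -/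
def IsOptimalPair (μ : Measure unitInterval) (β p : ℝ) (σA σB : MixedStrategy) : Prop :=
  ∀ (τA τB : MixedStrategy) (i : Player),
    expectedUtility μ 1 β p τA τB i ≤ expectedUtility μ 1 β p σA σB i

/-- Probability that player `i` pulls the right arm at least once. -/
def exploreProb (μ : Measure unitInterval) (p : ℝ) (σA σB : MixedStrategy) (i : Player) :
    ENNReal :=
  gameLaw μ σA σB {x | ∃ t : ℕ, action p x.1 x.2.1 x.2.2 i t = Arm.R}

end Bandit

end

/-! A pull of the right arm is worth `θ - p` more than a pull of the left arm on average, and the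
choice of arm uses only randomness of earlier rounds. So the expected total reward of a player is `p
/ (1 - β)` plus the expectation of `(θ - p)` times the discounted number of right pulls; call this
second term the gain. If neither player explores, both gains vanish, and optimality forces the sum
of the two gains to be nonpositive for every pair of pure strategies. It remains to find a pair with
positive sum.

If `p < g`, Alice plays a single-player strategy of positive gain `G`, and Bob repeats her arm one
round later. Her arms convey what he needs from her rewards, so his gain is `β * G` and the sum is
`(1 + β) * G > 0`.

If `g ≤ p < phat`, Alice takes a strategy with positive gain at some `c` slightly below `g`.
Conditioning on the rewards of the left arm, which carry no information, one may assume that the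
strategy ignores them. Then its first right pull occurs in a deterministic round `k`, and raising
`c` to `p` costs at most `(p - c) * β ^ k / (1 - β)`. Bob again copies Alice with a delay, but omits
the copy of her first right pull. That pull is made without any information, so omitting it saves `β
^ (k + 1) * (p - m)`, where `m` is the mean of `μ`. Since `g ≥ m + β * w`
(`mean_add_le_gittinsIndex`), the saving is at least `β ^ (k + 2) * w`, which outweighs Alice's
possible loss and Bob's share of it.

For a single player with `p > g`, some `c < p` admits no positive gain. Passing from `c` to `p`
lowers the gain by `p - c` for each discounted right pull, so an optimal strategy almost surely has
no such pulls. -/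

namespace Bandit

/-! ### Independent uniform numbers: resampling and marginals -/

section Product

variable {ι κ : Type*}

/-- The product law of independent uniform numbers indexed by `ι`. -/
noncomputable abbrev uniformLaw (ι : Type*) : Measure (ι → unitInterval) :=
  Measure.infinitePi fun _ : ι => (volume : Measure unitInterval)

open Classical in
/-- The family that agrees with `u` on `A` and with `v` off `A`. -/
noncomputable def mix (A : Set ι) (x : (ι → unitInterval) × (ι → unitInterval)) :
    ι → unitInterval :=
  fun i => if i ∈ A then x.1 i else x.2 i

lemma measurable_mix (A : Set ι) : Measurable (mix A) := by
  refine measurable_pi_lambda _ fun i => ?_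
  unfold mix
  split_ifs <;> fun_prop

/-- On a finite box the coordinates in `A` and those off `A` give complementary factors of one
product. This resampling identity serves as the independence statement throughout. -/
lemma measurePreserving_mix (A : Set ι) :
    MeasurePreserving (mix A) ((uniformLaw ι).prod (uniformLaw ι)) (uniformLaw ι) := by
  classical
  refine ⟨measurable_mix A, Measure.eq_infinitePi _ fun s t ht => ?_⟩
  rw [Measure.map_apply (measurable_mix A)
    (MeasurableSet.pi s.countable_toSet fun i _ => ht i)]
  have h : mix A ⁻¹' (Set.pi s t) =
      (Set.pi (s.filter (· ∈ A) : Finset ι) t) ×ˢ (Set.pi (s.filter (· ∉ A) : Finset ι) t) := by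
    ext x
    simp only [Set.mem_preimage, Set.mem_pi, Set.mem_prod, mix, Finset.mem_coe, Finset.mem_filter]
    constructor
    · intro h
      refine ⟨fun i hi => ?_, fun i hi => ?_⟩
      · simpa [hi.2] using h i hi.1
      · simpa [hi.2] using h i hi.1
    · rintro ⟨h1, h2⟩ i hi
      by_cases hA : i ∈ A
      · simpa [hA] using h1 i ⟨hi, hA⟩
      · simpa [hA] using h2 i ⟨hi, hA⟩
  rw [h, Measure.prod_prod, Measure.infinitePi_pi _ (fun i _ => ht i),
    Measure.infinitePi_pi _ (fun i _ => ht i), Finset.prod_filter_mul_prod_filter_not]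

lemma measurePreserving_comp_injective {f : κ → ι} (hf : f.Injective) :
    MeasurePreserving (fun u : ι → unitInterval => u ∘ f) (uniformLaw ι) (uniformLaw κ) := by
  classical
  have hm : Measurable (fun u : ι → unitInterval => u ∘ f) :=
    measurable_pi_lambda _ fun i => measurable_pi_apply (f i)
  refine ⟨hm, Measure.eq_infinitePi _ fun s t ht => ?_⟩
  rw [Measure.map_apply hm (MeasurableSet.pi s.countable_toSet fun i _ => ht i)]
  -- The side at `i` is an intersection over the preimages of `i`, which avoids an inverse of `f`;
  -- injectivity reduces it to a single `t k`.
  have h : (fun u : ι → unitInterval => u ∘ f) ⁻¹' (Set.pi s t) =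
      Set.pi (s.image f : Finset ι)
        (fun i => {y | ∀ k ∈ s, f k = i → y ∈ t k}) := by
    ext u
    simp only [Set.mem_preimage, Set.mem_pi, Finset.mem_coe, Function.comp_apply,
      Finset.mem_image, Set.mem_ofPred_eq]
    constructor
    · rintro h _ _ k hk rfl
      exact h k hk
    · intro h k hk
      exact h (f k) ⟨k, hk, rfl⟩ k hk rfl
  have h2 : ∀ k ∈ s, {y | ∀ l ∈ s, f l = f k → y ∈ t l} = t k := by
    intro k hk
    ext y
    refine ⟨fun h => h k hk rfl, fun h l _ e => ?_⟩
    rwa [hf e]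
  rw [h, Measure.infinitePi_pi, Finset.prod_image (fun a _ b _ e => hf e)]
  · exact Finset.prod_congr rfl fun k hk => by rw [h2 k hk]
  · intro i hi
    obtain ⟨k, hk, rfl⟩ := Finset.mem_image.1 hi
    rw [h2 k hk]
    exact ht k

lemma integral_uniform_lt {q : ℝ} (h0 : 0 ≤ q) (h1 : q ≤ 1) (j : ι) :
    ∫ u, (if ((u j : unitInterval) : ℝ) < q then (1 : ℝ) else 0) ∂(uniformLaw ι) = q := by
  have hs : MeasurableSet {y : unitInterval | (y : ℝ) < q} :=
    measurableSet_lt measurable_subtype_coe measurable_const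
  have e := (measurePreserving_eval_infinitePi
    (fun _ : ι => (volume : Measure unitInterval)) j)
  have h := integral_map (μ := uniformLaw ι) (φ := Function.eval j) (f := fun y : unitInterval =>
    if (y : ℝ) < q then (1 : ℝ) else 0) e.measurable.aemeasurable
      (Measurable.ite hs measurable_const measurable_const).aestronglyMeasurable
  rw [e.map_eq] at h
  refine h.symm.trans ?_
  have : (fun y : unitInterval => if (y : ℝ) < q then (1 : ℝ) else 0)
      = Set.indicator {y : unitInterval | (y : ℝ) < q} 1 := by
    ext y; simp [Set.indicator_apply]
  rw [this, integral_indicator_one hs]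
  have h3 : {y : unitInterval | (y : ℝ) < q} = Set.Iio (⟨q, h0, h1⟩ : unitInterval) := by
    ext y; simp [← Subtype.coe_lt_coe]
  rw [h3, measureReal_def, unitInterval.volume_Iio]
  simp [h0]

/-- Resampling coordinate `j` alone leaves `f` unchanged and makes the indicator an independent
factor of mean `q`. -/
lemma integral_mul_uniform_lt {q : ℝ} (h0 : 0 ≤ q) (h1 : q ≤ 1) [DecidableEq ι] (j : ι)
    {f : (ι → unitInterval) → ℝ} (hf : Measurable f)
    (hinv : ∀ u y, f (Function.update u j y) = f u) :
    ∫ u, f u * (if ((u j : unitInterval) : ℝ) < q then (1 : ℝ) else 0) ∂(uniformLaw ι)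
      = ∫ u, f u * q ∂(uniformLaw ι) := by
  have hm : Measurable fun u : ι → unitInterval =>
      f u * (if ((u j : unitInterval) : ℝ) < q then (1 : ℝ) else 0) :=
    hf.mul (Measurable.ite (measurableSet_lt (by fun_prop) measurable_const)
      measurable_const measurable_const)
  rw [← (measurePreserving_mix (ι := ι) {j}ᶜ).map_eq,
    integral_map (measurable_mix _).aemeasurable hm.aestronglyMeasurable,
    (measurePreserving_mix (ι := ι) {j}ᶜ).map_eq]
  have e : ∀ x : (ι → unitInterval) × (ι → unitInterval),
      mix {j}ᶜ x = Function.update x.1 j (x.2 j) := by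
    intro x
    ext i
    by_cases h : i = j
    · subst h; simp [mix]
    · simp [mix, h]
  simp_rw [e, hinv, Function.update_self]
  rw [integral_prod_mul f (fun u : ι → unitInterval => if (u j : ℝ) < q then (1 : ℝ) else 0),
    integral_uniform_lt h0 h1, integral_mul_const]

end Product

/-! ### Discounted sums and the discounted number of right pulls -/

section Discounting

instance : DiscreteMeasurableSpace Arm := ⟨fun _ => trivial⟩

instance : Finite Arm :=
  Finite.of_surjective (fun b : Bool => cond b Arm.L Arm.R) fun a => by
    cases a
    exacts [⟨true, rfl⟩, ⟨false, rfl⟩]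

/-- Whether an arm is the right arm. -/
def isRight : Arm → Bool
  | Arm.L => false
  | Arm.R => true

lemma isRight_eq_true {a : Arm} : isRight a = true ↔ a = Arm.R := by
  cases a <;> simp [isRight]

/-- The discounted number of pulls of the right arm. -/
noncomputable def riskyTime (β : ℝ) (A : ℕ → Arm) : ℝ :=
  discountedSum β fun t => isRight (A t)

variable {β : ℝ}

lemma summable_discounted (hβ0 : 0 < β) (hβ1 : β < 1) {x : ℕ → ℝ} (hx : ∀ t, |x t| ≤ 1) :
    Summable fun t => β ^ t * x t := by
  refine Summable.of_norm_bounded (summable_geometric_of_lt_one hβ0.le hβ1) fun t => ?_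
  rw [Real.norm_eq_abs, abs_mul, abs_of_nonneg (pow_nonneg hβ0.le t)]
  exact mul_le_of_le_one_right (pow_nonneg hβ0.le t) (hx t)

lemma abs_bit_le_one (b : Bool) : |(if b then (1 : ℝ) else 0)| ≤ 1 := by
  cases b <;> simp

lemma summable_bits (hβ0 : 0 < β) (hβ1 : β < 1) (x : ℕ → Bool) :
    Summable fun t => β ^ t * (if x t then (1 : ℝ) else 0) :=
  summable_discounted hβ0 hβ1 fun t => abs_bit_le_one (x t)

lemma discountedSum_nonneg (hβ0 : 0 < β) (x : ℕ → Bool) : 0 ≤ discountedSum β x :=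
  tsum_nonneg fun t => mul_nonneg (pow_nonneg hβ0.le t) (by split_ifs <;> simp)

lemma discountedSum_le (hβ0 : 0 < β) (hβ1 : β < 1) (x : ℕ → Bool) :
    discountedSum β x ≤ (1 - β)⁻¹ := by
  rw [← tsum_geometric_of_lt_one hβ0.le hβ1]
  refine (summable_bits hβ0 hβ1 x).tsum_le_tsum (fun t => ?_)
    (summable_geometric_of_lt_one hβ0.le hβ1)
  exact mul_le_of_le_one_right (pow_nonneg hβ0.le t) (by split_ifs <;> simp)

lemma discountedSum_pos (hβ0 : 0 < β) (hβ1 : β < 1) {x : ℕ → Bool} {t : ℕ} (ht : x t = true) :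
    0 < discountedSum β x :=
  (summable_bits hβ0 hβ1 x).tsum_pos
    (fun t => mul_nonneg (pow_nonneg hβ0.le t) (by split_ifs <;> simp)) t
    (by simpa [ht] using pow_pos hβ0 t)

lemma discountedSum_succ (hβ0 : 0 < β) (hβ1 : β < 1) (x : ℕ → Bool) :
    discountedSum β x = (if x 0 then 1 else 0) + β * discountedSum β fun t => x (t + 1) := by
  unfold discountedSum
  rw [(summable_bits hβ0 hβ1 x).tsum_eq_zero_add, ← tsum_mul_left]
  simp only [pow_zero, one_mul, pow_succ']
  congr 1
  exact tsum_congr fun t => by ring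

lemma discountedSum_shift (hβ0 : 0 < β) (hβ1 : β < 1) {x : ℕ → Bool} {k : ℕ}
    (hx : ∀ t < k, x t = false) :
    discountedSum β x = β ^ k * discountedSum β fun t => x (t + k) := by
  induction k generalizing x with
  | zero => simp
  | succ k ih =>
    rw [discountedSum_succ hβ0 hβ1, ih (x := fun t => x (t + 1)) fun t ht => hx _ (by omega),
      hx 0 (by omega)]
    simp only [Bool.false_eq_true, if_false, zero_add, ← mul_assoc, pow_succ']
    congr 2

lemma discountedSum_true (hβ0 : 0 < β) (hβ1 : β < 1) :
    discountedSum β (fun _ => true) = (1 - β)⁻¹ := by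
  simp [discountedSum, tsum_geometric_of_lt_one hβ0.le hβ1]

lemma discountedSum_false : discountedSum β (fun _ => false) = 0 := by
  simp [discountedSum]

lemma measurable_discountedSum (hβ0 : 0 < β) (hβ1 : β < 1) : Measurable (discountedSum β) := by
  refine measurable_of_tendsto_metrizable
    (f := fun n x => ∑ t ∈ Finset.range n, β ^ t * (if x t then (1 : ℝ) else 0)) (fun n => ?_) ?_
  · refine Finset.measurable_sum _ fun t _ => measurable_const.mul ?_
    exact (measurable_of_countable fun b : Bool => if b then (1 : ℝ) else 0).comp
      (measurable_pi_apply t)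
  · rw [tendsto_pi_nhds]
    exact fun x => (summable_bits hβ0 hβ1 x).hasSum.tendsto_sum_nat

lemma measurable_riskyTime (hβ0 : 0 < β) (hβ1 : β < 1) : Measurable (riskyTime β) := by
  refine (measurable_discountedSum hβ0 hβ1).comp (measurable_pi_lambda _ fun t => ?_)
  exact (measurable_of_countable isRight).comp (measurable_pi_apply t)

variable {Ω : Type*} [MeasurableSpace Ω] {P : Measure Ω} [IsProbabilityMeasure P]

lemma integral_discounted (hβ0 : 0 < β) (hβ1 : β < 1) {f : ℕ → Ω → ℝ}
    (hf : ∀ t, Measurable (f t)) (hb : ∀ t ω, |f t ω| ≤ 1) :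
    ∫ ω, ∑' t, β ^ t * f t ω ∂P = ∑' t, β ^ t * ∫ ω, f t ω ∂P := by
  have hbd : ∀ t ω, ‖β ^ t * f t ω‖ ≤ β ^ t := fun t ω => by
    rw [Real.norm_eq_abs, abs_mul, abs_of_nonneg (pow_nonneg hβ0.le t)]
    exact mul_le_of_le_one_right (pow_nonneg hβ0.le t) (hb t ω)
  have hint : ∀ t, Integrable (fun ω => β ^ t * f t ω) P := fun t =>
    Integrable.of_bound ((hf t).const_mul _).aestronglyMeasurable (β ^ t)
      (Filter.Eventually.of_forall (hbd t))
  rw [← integral_tsum_of_summable_integral_norm hint]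
  · exact tsum_congr fun t => integral_const_mul _ _
  · refine Summable.of_nonneg_of_le (fun t => integral_nonneg fun ω => norm_nonneg _) (fun t => ?_)
      (summable_geometric_of_lt_one hβ0.le hβ1)
    refine (integral_mono (hint t).norm (integrable_const (β ^ t)) (hbd t)).trans ?_
    simp

lemma integrable_mul_riskyTime (hβ0 : 0 < β) (hβ1 : β < 1) {f : Ω → ℝ} (hf : Measurable f)
    {C : ℝ} (hC : ∀ ω, |f ω| ≤ C) {A : Ω → ℕ → Arm} (hA : Measurable A) :
    Integrable (fun ω => f ω * riskyTime β (A ω)) P := by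
  refine Integrable.of_bound
    (hf.mul ((measurable_riskyTime hβ0 hβ1).comp hA)).aestronglyMeasurable (C * (1 - β)⁻¹)
    (Filter.Eventually.of_forall fun ω => ?_)
  rw [Real.norm_eq_abs, abs_mul]
  have h0 : 0 ≤ riskyTime β (A ω) := discountedSum_nonneg hβ0 _
  rw [abs_of_nonneg h0]
  exact mul_le_mul (hC ω) (discountedSum_le hβ0 hβ1 _) h0 ((abs_nonneg _).trans (hC ω))

lemma integrable_discountedSum (hβ0 : 0 < β) (hβ1 : β < 1) {X : Ω → ℕ → Bool}
    (hX : Measurable X) : Integrable (fun ω => discountedSum β (X ω)) P := by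
  refine Integrable.of_bound
    ((measurable_discountedSum hβ0 hβ1).comp hX).aestronglyMeasurable ((1 - β)⁻¹)
    (Filter.Eventually.of_forall fun ω => ?_)
  rw [Real.norm_eq_abs, abs_of_nonneg (discountedSum_nonneg hβ0 _)]
  exact discountedSum_le hβ0 hβ1 _

end Discounting

/-! ### Expected reward in terms of right pulls -/

section Value

variable {ι : Type*} {μ : Measure unitInterval} [IsProbabilityMeasure μ] {β p : ℝ}

lemma integral_mul_bit [DecidableEq ι] {f : unitInterval × (ι → unitInterval) → ℝ}
    (hf : Measurable f) {C : ℝ} (hC : ∀ ω, |f ω| ≤ C) {q : unitInterval → ℝ} (hq : Measurable q)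
    (h0 : ∀ θ, 0 ≤ q θ) (h1 : ∀ θ, q θ ≤ 1) (j : ι)
    (hinv : ∀ θ u y, f (θ, Function.update u j y) = f (θ, u)) :
    ∫ ω, f ω * (if (ω.2 j : ℝ) < q ω.1 then (1 : ℝ) else 0) ∂(μ.prod (uniformLaw ι))
      = ∫ ω, f ω * q ω.1 ∂(μ.prod (uniformLaw ι)) := by
  have hms : MeasurableSet {ω : unitInterval × (ι → unitInterval) | (ω.2 j : ℝ) < q ω.1} :=
    measurableSet_lt (by fun_prop) (by fun_prop)
  rw [integral_prod, integral_prod]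
  · refine integral_congr_ae (Filter.Eventually.of_forall fun θ => ?_)
    exact integral_mul_uniform_lt (h0 θ) (h1 θ) j (f := fun u => f (θ, u)) (by fun_prop) (hinv θ)
  · refine Integrable.of_bound (by fun_prop) C (Filter.Eventually.of_forall fun ω => ?_)
    rw [Real.norm_eq_abs, abs_mul, abs_of_nonneg (h0 ω.1)]
    exact (mul_le_of_le_one_right (abs_nonneg _) (h1 ω.1)).trans (hC ω)
  · refine Integrable.of_bound (hf.mul (Measurable.ite hms measurable_const
      measurable_const)).aestronglyMeasurable C (Filter.Eventually.of_forall fun ω => ?_)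
    rw [Real.norm_eq_abs, abs_mul]
    refine (mul_le_of_le_one_right (abs_nonneg _) ?_).trans (hC ω)
    split_ifs <;> simp

lemma measurable_rewardBit (p : ℝ) :
    Measurable fun x : unitInterval × unitInterval × Arm => rewardBit p x.1 x.2.1 x.2.2 := by
  have hs : MeasurableSet {x : unitInterval × unitInterval × Arm |
      (x.2.1 : ℝ) < successProb p x.1 x.2.2} := by
    refine measurableSet_lt (by fun_prop) ?_
    have : Measurable fun y : (unitInterval × unitInterval) × Arm => successProb p y.1.1 y.2 := by
      refine measurable_from_prod_countable_left fun a => ?_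
      cases a <;> simp only [successProb] <;> fun_prop
    exact this.comp (g := fun y : (unitInterval × unitInterval) × Arm => successProb p y.1.1 y.2)
      (f := fun x : unitInterval × unitInterval × Arm => ((x.1, x.2.1), x.2.2)) (by fun_prop)
  refine measurable_to_bool ?_
  convert hs using 1
  ext x
  simp [rewardBit]

lemma measurable_rewards {Ω : Type*} [MeasurableSpace Ω] (p : ℝ) {A : Ω → ℕ → Arm}
    (hA : Measurable A) {N : Ω → unitInterval × (ι → unitInterval)} (hN : Measurable N)
    (j : ℕ → Arm → ι) :
    Measurable fun ω t => rewardBit p (N ω).1 ((N ω).2 (j t (A ω t))) (A ω t) := by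
  refine measurable_pi_lambda _ fun t => ?_
  have hAt : Measurable fun ω => A ω t := (measurable_pi_apply t).comp hA
  have h : Measurable fun x : (ι → unitInterval) × Arm => x.1 (j t x.2) :=
    measurable_from_prod_countable_left fun a => measurable_pi_apply (j t a)
  exact (measurable_rewardBit p).comp (hN.fst.prodMk ((h.comp (hN.snd.prodMk hAt)).prodMk hAt))

/-- The number that decides the reward has an index depending on the chosen arm. Splitting by arm
makes the index fixed, and the invariance hypothesis says that the choice of arm does not look at
that number. -/
lemma integral_reward (hp0 : 0 ≤ p) (hp1 : p ≤ 1)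
    {a : unitInterval × (ι → unitInterval) → Arm} (ha : Measurable a) (j : Arm → ι)
    [DecidableEq ι]
    (hinv : ∀ x θ u y, a (θ, Function.update u (j x) y) = a (θ, u)) :
    ∫ ω, (if rewardBit p ω.1 (ω.2 (j (a ω))) (a ω) then (1 : ℝ) else 0) ∂(μ.prod (uniformLaw ι))
      = ∫ ω, (p + (ω.1 - p) * (if isRight (a ω) then 1 else 0)) ∂(μ.prod (uniformLaw ι)) := by
  set P := μ.prod (uniformLaw ι)
  let g : Bool → Arm → ℝ := fun b x => if isRight x = b then 1 else 0
  have hgm : ∀ b, Measurable (g b) := fun b => measurable_of_countable _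
  have hgb : ∀ b x, |g b x| ≤ 1 := fun b x => by simp only [g]; split_ifs <;> simp
  have hL := integral_mul_bit (μ := μ) (f := fun ω => g false (a ω)) ((hgm _).comp ha)
    (fun ω => hgb _ _) (q := fun _ => p) (by fun_prop) (fun _ => hp0) (fun _ => hp1) (j Arm.L)
    (fun θ u y => by rw [hinv])
  have hR := integral_mul_bit (μ := μ) (f := fun ω => g true (a ω)) ((hgm _).comp ha)
    (fun ω => hgb _ _) (q := fun θ => θ) (by fun_prop) (fun θ => θ.2.1) (fun θ => θ.2.2) (j Arm.R)
    (fun θ u y => by rw [hinv])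
  have hbint : ∀ b {h : unitInterval × (ι → unitInterval) → ℝ}, Measurable h → (∀ ω, |h ω| ≤ 1) →
      Integrable (fun ω => g b (a ω) * h ω) P := fun b h hh hb =>
    Integrable.of_bound (((hgm b).comp ha).mul hh).aestronglyMeasurable 1
      (Filter.Eventually.of_forall fun ω => by
        rw [Real.norm_eq_abs, abs_mul]
        exact mul_le_one₀ (hgb _ _) (abs_nonneg _) (hb ω))
  have hmb : ∀ {q : unitInterval → ℝ} (_ : Measurable q) (i : ι),
      Measurable fun ω : unitInterval × (ι → unitInterval) =>
        if (ω.2 i : ℝ) < q ω.1 then (1 : ℝ) else 0 := fun hq i =>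
    Measurable.ite (measurableSet_lt (by fun_prop) (by fun_prop)) measurable_const measurable_const
  calc _ = ∫ ω, (g false (a ω) * (if (ω.2 (j Arm.L) : ℝ) < p then (1 : ℝ) else 0)
        + g true (a ω) * (if (ω.2 (j Arm.R) : ℝ) < ω.1 then (1 : ℝ) else 0)) ∂P := by
        congr 1
        ext ω
        rcases h : a ω
        · by_cases hlt : (ω.2 (j Arm.L) : ℝ) < p <;> simp [g, isRight, rewardBit, successProb, hlt]
        · by_cases hlt : (ω.2 (j Arm.R) : ℝ) < ω.1 <;>
            simp [g, isRight, rewardBit, successProb, hlt]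
    _ = ∫ ω, (g false (a ω) * p + g true (a ω) * ω.1) ∂P := by
        rw [integral_add, integral_add, hL, hR]
        · exact hbint _ (by fun_prop) fun ω => by rw [abs_of_nonneg hp0]; exact hp1
        · exact hbint _ (by fun_prop) fun ω => by rw [abs_of_nonneg ω.1.2.1]; exact ω.1.2.2
        · exact hbint _ (hmb (q := fun _ => p) (by fun_prop) _)
            fun ω => by split_ifs <;> simp
        · exact hbint _ (hmb (q := fun θ => θ) (by fun_prop) _)
            fun ω => by split_ifs <;> simp
    _ = _ := by
        congr 1
        ext ω
        cases h : a ω <;> simp [g, isRight]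

/-- The expected total reward exceeds that of the safe arm by the expected discounted advantage
of the pulls of the risky arm. -/
lemma integral_discounted_reward (hβ0 : 0 < β) (hβ1 : β < 1) (hp0 : 0 ≤ p) (hp1 : p ≤ 1)
    [DecidableEq ι] {A : unitInterval × (ι → unitInterval) → ℕ → Arm} (hA : Measurable A)
    (j : ℕ → Arm → ι)
    (hinv : ∀ t x θ u y, A (θ, Function.update u (j t x) y) t = A (θ, u) t) :
    ∫ ω, discountedSum β (fun t => rewardBit p ω.1 (ω.2 (j t (A ω t))) (A ω t))
        ∂(μ.prod (uniformLaw ι))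
      = p * (1 - β)⁻¹ + ∫ ω, (ω.1 - p) * riskyTime β (A ω) ∂(μ.prod (uniformLaw ι)) := by
  have hAt : ∀ t, Measurable fun ω => A ω t := fun t => (measurable_pi_apply t).comp hA
  have hbit : Measurable fun b : Bool => if b then (1 : ℝ) else 0 := measurable_of_countable _
  have hin : Measurable fun x : Arm => if isRight x then (1 : ℝ) else 0 :=
    measurable_of_countable _
  have hX := measurable_rewards p hA measurable_id j
  simp only [discountedSum]
  rw [integral_discounted hβ0 hβ1 (f := fun t (ω : unitInterval × (ι → unitInterval)) =>
      if rewardBit p ω.1 (ω.2 (j t (A ω t))) (A ω t) then (1 : ℝ) else 0)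
    (fun t => hbit.comp ((measurable_pi_apply t).comp hX)) fun t ω => abs_bit_le_one _]
  simp_rw [fun t => integral_reward (μ := μ) hp0 hp1 (hAt t) (j t) (hinv t)]
  -- The expression equals `p` or `θ`.
  have hle : ∀ (θ : unitInterval) (b : Bool), |p + (θ - p) * (if b then (1 : ℝ) else 0)| ≤ 1 := by
    intro θ b
    cases b
    · simpa [abs_of_nonneg hp0] using hp1
    · simpa [abs_of_nonneg θ.2.1] using θ.2.2
  rw [← integral_discounted hβ0 hβ1 (P := μ.prod (uniformLaw ι))
    (f := fun t ω => p + (ω.1 - p) * (if isRight (A ω t) then (1 : ℝ) else 0))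
    (fun t => by have := hin.comp (hAt t); fun_prop) fun t ω => hle _ _]
  have e : ∀ ω : unitInterval × (ι → unitInterval),
      ∑' t, β ^ t * (p + (ω.1 - p) * (if isRight (A ω t) then (1 : ℝ) else 0))
        = p * (1 - β)⁻¹ + (ω.1 - p) * riskyTime β (A ω) := by
    intro ω
    rw [riskyTime, discountedSum, ← tsum_geometric_of_lt_one hβ0.le hβ1, ← tsum_mul_left,
      ← tsum_mul_left, ← Summable.tsum_add]
    · exact tsum_congr fun t => by ring
    · exact (summable_geometric_of_lt_one hβ0.le hβ1).mul_left _
    · exact (summable_bits hβ0 hβ1 _).mul_left _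
  simp_rw [e]
  rw [integral_add (integrable_const _)]
  · simp
  · refine integrable_mul_riskyTime hβ0 hβ1 (C := 1) (by fun_prop) (fun ω => ?_) hA
    rw [abs_le]
    constructor <;> linarith [ω.1.2.1, ω.1.2.2]

end Value

/-! ### Single player: gains and irrelevance of the left arm's rewards -/

section Single

lemma measurable_singleAction (p : ℝ) :
    Measurable fun x : SinglePure × SingleNature => singleAction p x.1 x.2 := by
  refine measurable_pi_lambda _ fun t => ?_
  induction t using Nat.strong_induction_on with
  | _ t ih =>
    simp only [singleAction.eq_1 p _ _ t]
    -- Histories of length `t` form a countable set, so evaluation of a strategy is measurable once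
    -- it is so at each fixed history.
    have hev : Measurable fun y : SinglePure × (Fin t → Arm) × (Fin t → Bool) =>
        y.1 t y.2.1 y.2.2 := measurable_from_prod_countable_left fun z =>
      (measurable_pi_apply z.2).comp ((measurable_pi_apply z.1).comp (measurable_pi_apply t))
    have hu : ∀ s : ℕ, Measurable fun y : (ℕ × Arm → unitInterval) × Arm => y.1 (s, y.2) :=
      fun s => measurable_from_prod_countable_left fun a => measurable_pi_apply (s, a)
    refine hev.comp (measurable_fst.prodMk (Measurable.prodMk ?_ ?_))
    · exact measurable_pi_lambda _ fun s => ih s s.isLt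
    · refine measurable_pi_lambda _ fun s => ?_
      exact (measurable_rewardBit p).comp <| measurable_snd.fst.prodMk
        (((hu s).comp (measurable_snd.snd.prodMk (ih s s.isLt))).prodMk (ih s s.isLt))

/-- Arms up to round `s` use only numbers of rounds before `s`; this is the invariance needed to
average the reward of round `s`. -/
lemma singleAction_update (p : ℝ) (S : SinglePure) (θ : unitInterval) (u : ℕ × Arm → unitInterval)
    (s : ℕ) (x : Arm) (y : unitInterval) [DecidableEq (ℕ × Arm)] {t : ℕ} (ht : t ≤ s) :
    singleAction p S (θ, Function.update u (s, x) y) t = singleAction p S (θ, u) t := by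
  induction t using Nat.strong_induction_on with
  | _ t ih =>
    have h1 : ∀ r : Fin t, singleAction p S (θ, Function.update u (s, x) y) r
        = singleAction p S (θ, u) r := fun r => ih r r.isLt (by omega)
    have h2 : ∀ (r : Fin t) (a : Arm), Function.update u (s, x) y ((r : ℕ), a) = u (r, a) :=
      fun r a => Function.update_of_ne (by simp only [ne_eq, Prod.mk.injEq]; omega) _ _
    rw [singleAction, singleAction]
    simp only [h1, h2]

variable {μ : Measure unitInterval} [IsProbabilityMeasure μ] {β p : ℝ}

instance : IsProbabilityMeasure (singleNatureLaw μ) := by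
  unfold singleNatureLaw; infer_instance

/-- The expected discounted advantage, over a safe arm of success probability `c`, of the pulls
of the risky arm. -/
noncomputable def singleGain (μ : Measure unitInterval) (β c p : ℝ) (S : SinglePure) : ℝ :=
  ∫ ω, ((ω.1 : ℝ) - c) * riskyTime β (singleAction p S ω) ∂(singleNatureLaw μ)

lemma abs_sub_le_one (θ : unitInterval) {c : ℝ} (h0 : 0 ≤ c) (h1 : c ≤ 1) : |(θ : ℝ) - c| ≤ 1 := by
  rw [abs_le]
  constructor <;> linarith [θ.2.1, θ.2.2]

lemma measurable_singleAction_right (p : ℝ) (S : SinglePure) : Measurable (singleAction p S) :=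
  (measurable_singleAction p).comp measurable_prodMk_left

lemma integral_single (hβ0 : 0 < β) (hβ1 : β < 1) (hp0 : 0 ≤ p) (hp1 : p ≤ 1) (S : SinglePure) :
    ∫ ω, discountedSum β (singleReward p S ω) ∂(singleNatureLaw μ)
      = p * (1 - β)⁻¹ + singleGain μ β p p S := by
  classical
  exact integral_discounted_reward hβ0 hβ1 hp0 hp1 (measurable_singleAction_right p S)
    (fun t a => (t, a)) fun t x θ u y => singleAction_update p S θ u t x y le_rfl

lemma singleValue_eq (hβ0 : 0 < β) (hβ1 : β < 1) (hp0 : 0 ≤ p) (hp1 : p ≤ 1)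
    (σ : ProbabilityMeasure SinglePure) :
    singleValue μ β p σ = p * (1 - β)⁻¹ + ∫ x : SinglePure × SingleNature,
      ((x.2.1 : ℝ) - p) * riskyTime β (singleAction p x.1 x.2)
        ∂((σ : Measure SinglePure).prod (singleNatureLaw μ)) := by
  have hint : Integrable (fun x : SinglePure × SingleNature =>
      ((x.2.1 : ℝ) - p) * riskyTime β (singleAction p x.1 x.2))
        ((σ : Measure SinglePure).prod (singleNatureLaw μ)) :=
    integrable_mul_riskyTime hβ0 hβ1 (by fun_prop) (fun x => abs_sub_le_one x.2.1 hp0 hp1)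
      (measurable_singleAction p)
  have hint' : Integrable (fun x : SinglePure × SingleNature =>
      discountedSum β (singleReward p x.1 x.2))
        ((σ : Measure SinglePure).prod (singleNatureLaw μ)) :=
    integrable_discountedSum hβ0 hβ1
      (measurable_rewards p (measurable_singleAction p) measurable_snd fun t a => (t, a))
  unfold singleValue
  rw [integral_prod _ hint',
    integral_prod _ hint]
  simp_rw [integral_single hβ0 hβ1 hp0 hp1]
  rw [integral_add (integrable_const _)]
  · simp [singleGain]
  · exact hint.integral_prod_left

lemma rewardBit_left (p θ θ' : ℝ) (u : unitInterval) :
    rewardBit p θ u Arm.L = rewardBit p θ' u Arm.L := rfl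

lemma rewardBit_right (p q θ : ℝ) (u : unitInterval) :
    rewardBit p θ u Arm.R = rewardBit q θ u Arm.R := rfl

/-- Replace the observed bits of the left arm by bits computed from the numbers `u`. -/
noncomputable def freeze (p : ℝ) (S : SinglePure) (u : ℕ × Arm → unitInterval) : SinglePure :=
  fun t h b => S t h fun s =>
    if isRight (h s) then b s else rewardBit p 0 (u ((s : ℕ), Arm.L)) Arm.L

/-- The strategy disregards the bits observed at pulls of the left arm. -/
def IgnoresLeft (S : SinglePure) : Prop :=
  ∀ t h b b', (∀ s, h s = Arm.R → b s = b' s) → S t h b = S t h b'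

lemma ignoresLeft_freeze (p : ℝ) (S : SinglePure) (u : ℕ × Arm → unitInterval) :
    IgnoresLeft (freeze p S u) := by
  intro t h b b' hb
  simp only [freeze]
  congr 1
  ext s
  cases hs : h s
  · simp [isRight]
  · simp [isRight, hb s hs]

lemma IgnoresLeft.singleAction_congr {S : SinglePure} (hS : IgnoresLeft S) (p q : ℝ)
    (ω : SingleNature) (t : ℕ) : singleAction p S ω t = singleAction q S ω t := by
  induction t using Nat.strong_induction_on with
  | _ t ih =>
    have h1 : ∀ r : Fin t, singleAction p S ω r = singleAction q S ω r := fun r => ih r r.isLt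
    rw [singleAction, singleAction]
    simp only [h1]
    refine hS _ _ _ _ fun s hs => ?_
    simp only [hs, rewardBit_right p q]

/-- With left numbers taken from `u` and right numbers from `v`, the frozen strategy already knows
the left bits at parameter `p`, so it can be played at any `q`. The value `0` of `θ` in `freeze` is
a placeholder, since left bits do not depend on `θ`. -/
lemma singleAction_mix (p q : ℝ) (S : SinglePure) (θ : unitInterval)
    (u v : ℕ × Arm → unitInterval) (t : ℕ) :
    singleAction p S (θ, mix {x | x.2 = Arm.L} (u, v)) t
      = singleAction q (freeze p S u) (θ, v) t := by
  induction t using Nat.strong_induction_on with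
  | _ t ih =>
    have h1 : ∀ r : Fin t, singleAction p S (θ, mix {x | x.2 = Arm.L} (u, v)) r
      = singleAction q (freeze p S u) (θ, v) r := fun r => ih r r.isLt
    rw [singleAction, singleAction]
    simp only [h1]
    simp only [freeze]
    congr 1
    ext s
    cases hs : singleAction q (freeze p S u) (θ, v) s
    · simp [isRight, mix, rewardBit_left p θ 0]
    · simp [isRight, mix, rewardBit_right p q]

/-- Averaging over the bits of the left arm turns the gain of a strategy into the mean of the
gains of strategies that ignore these bits. -/
lemma singleGain_eq_integral_freeze (hβ0 : 0 < β) (hβ1 : β < 1) {c : ℝ} (hc0 : 0 ≤ c) (hc1 : c ≤ 1)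
    (p q : ℝ) (S : SinglePure) :
    singleGain μ β c p S
      = ∫ u, singleGain μ β c q (freeze p S u) ∂(uniformLaw (ℕ × Arm)) := by
  set A : Set (ℕ × Arm) := {x | x.2 = Arm.L}
  have hm : Measurable fun ω : SingleNature =>
      ((ω.1 : ℝ) - c) * riskyTime β (singleAction p S ω) := by
    have := (measurable_riskyTime hβ0 hβ1).comp (measurable_singleAction_right p S)
    simp only [Function.comp_def] at this
    fun_prop
  have hmp : MeasurePreserving
      (fun x : (ℕ × Arm → unitInterval) × SingleNature =>
        ((x.2.1, mix A (x.1, x.2.2)) : SingleNature))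
      ((uniformLaw (ℕ × Arm)).prod (singleNatureLaw μ)) (singleNatureLaw μ) :=
    ((MeasurePreserving.id μ).prod (measurePreserving_mix A)).comp
      ((measurePreserving_prodAssoc _ _ _).comp
        ((Measure.measurePreserving_swap.prod (MeasurePreserving.id _)).comp
          (measurePreserving_prodAssoc _ _ _).symm))
  have hb : ∀ ω : SingleNature,
      ‖((ω.1 : ℝ) - c) * riskyTime β (singleAction p S ω)‖ ≤ 1 * (1 - β)⁻¹ := fun ω => by
    have h0 : 0 ≤ riskyTime β (singleAction p S ω) := discountedSum_nonneg hβ0 _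
    rw [Real.norm_eq_abs, abs_mul, abs_of_nonneg h0]
    exact mul_le_mul (abs_sub_le_one _ hc0 hc1) (discountedSum_le hβ0 hβ1 _) h0 zero_le_one
  have hI : ∀ (u : ℕ × Arm → unitInterval) (θ : unitInterval) (v : ℕ × Arm → unitInterval), ((θ : ℝ) - c) * riskyTime β (singleAction p S (θ, mix A (u, v)))
      = ((θ : ℝ) - c) * riskyTime β (singleAction q (freeze p S u) (θ, v)) := fun u θ v => by
    congr 2
    ext t
    exact singleAction_mix p q S θ u v t
  unfold singleGain
  rw [← hmp.map_eq, integral_map hmp.measurable.aemeasurable hm.aestronglyMeasurable, hmp.map_eq,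
    integral_prod]
  · simp_rw [hI]
  · exact Integrable.of_bound (hm.comp hmp.measurable).aestronglyMeasurable _
      (Filter.Eventually.of_forall fun x => hb _)

end Single
-- Single player: optimality and the Gittins index
section SingleOptimality

variable {μ : Measure unitInterval} [IsProbabilityMeasure μ] {β p : ℝ}

/-- The mixed strategy that plays a pure strategy surely. -/
noncomputable def pureSingle (S : SinglePure) : ProbabilityMeasure SinglePure :=
  ⟨Measure.dirac S, inferInstance⟩

lemma measurable_advantage_single (hβ0 : 0 < β) (hβ1 : β < 1) (c p : ℝ) :
    Measurable fun x : SinglePure × SingleNature =>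
      ((x.2.1 : ℝ) - c) * riskyTime β (singleAction p x.1 x.2) := by
  have := (measurable_riskyTime hβ0 hβ1).comp (measurable_singleAction p)
  simp only [Function.comp_def] at this
  fun_prop

lemma singleValue_pure (hβ0 : 0 < β) (hβ1 : β < 1) (hp0 : 0 ≤ p) (hp1 : p ≤ 1) (S : SinglePure) :
    singleValue μ β p (pureSingle S) = p * (1 - β)⁻¹ + singleGain μ β p p S := by
  rw [singleValue_eq hβ0 hβ1 hp0 hp1]
  congr 1
  change ∫ x : SinglePure × SingleNature, ((x.2.1 : ℝ) - p) * riskyTime β (singleAction p x.1 x.2)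
    ∂((Measure.dirac S).prod (singleNatureLaw μ)) = _
  rw [Measure.dirac_prod, integral_map measurable_prodMk_left.aemeasurable
    (measurable_advantage_single hβ0 hβ1 p p).aestronglyMeasurable]
  rfl

lemma riskyTime_eq_zero_of_forall {A : ℕ → Arm} (h : ∀ t, A t = Arm.L) : riskyTime β A = 0 := by
  simp [riskyTime, discountedSum, h, isRight]

lemma singleValue_alwaysLeft (hβ0 : 0 < β) (hβ1 : β < 1) (hp0 : 0 ≤ p) (hp1 : p ≤ 1) :
    singleValue μ β p alwaysLeft = p * (1 - β)⁻¹ := by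
  have h := singleValue_pure (μ := μ) hβ0 hβ1 hp0 hp1 (fun _ _ _ => Arm.L)
  have h0 : singleGain μ β p p (fun _ _ _ => Arm.L) = 0 := by
    unfold singleGain
    have : ∀ ω, riskyTime β (singleAction p (fun _ _ _ => Arm.L) ω) = 0 := fun ω =>
      riskyTime_eq_zero_of_forall fun t => by rw [singleAction]
    simp [this]
  rwa [h0, add_zero] at h

lemma singleGain_nonpos_of_isOptimal (hβ0 : 0 < β) (hβ1 : β < 1) (hp0 : 0 ≤ p) (hp1 : p ≤ 1)
    (h : IsOptimalSingle μ β p alwaysLeft) (S : SinglePure) : singleGain μ β p p S ≤ 0 := by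
  have := h (pureSingle S)
  rw [singleValue_pure hβ0 hβ1 hp0 hp1, singleValue_alwaysLeft hβ0 hβ1 hp0 hp1] at this
  linarith

lemma integrable_advantage_single (hβ0 : 0 < β) (hβ1 : β < 1) {c : ℝ} (hc0 : 0 ≤ c) (hc1 : c ≤ 1)
    (p : ℝ) (σ : ProbabilityMeasure SinglePure) :
    Integrable (fun x : SinglePure × SingleNature =>
      ((x.2.1 : ℝ) - c) * riskyTime β (singleAction p x.1 x.2))
        ((σ : Measure SinglePure).prod (singleNatureLaw μ)) :=
  integrable_mul_riskyTime hβ0 hβ1 (by fun_prop) (fun x => abs_sub_le_one x.2.1 hc0 hc1)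
    (measurable_singleAction p)

lemma isOptimal_alwaysLeft_of_singleGain_nonpos (hβ0 : 0 < β) (hβ1 : β < 1) (hp0 : 0 ≤ p)
    (hp1 : p ≤ 1) (h : ∀ S, singleGain μ β p p S ≤ 0) : IsOptimalSingle μ β p alwaysLeft := by
  intro τ
  rw [singleValue_alwaysLeft hβ0 hβ1 hp0 hp1, singleValue_eq hβ0 hβ1 hp0 hp1,
    integral_prod _ (integrable_advantage_single hβ0 hβ1 hp0 hp1 p τ)]
  have := integral_nonpos (μ := (τ : Measure SinglePure)) (f := singleGain μ β p p) h
  simp only [singleGain] at this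
  linarith

lemma gittinsIndex_set_bddBelow {μ : Measure unitInterval} {β : ℝ} :
    BddBelow {p : ℝ | p ∈ Set.Icc (0 : ℝ) 1 ∧ IsOptimalSingle μ β p alwaysLeft} :=
  ⟨0, fun _ hp => hp.1.1⟩

/-- Since `θ ≤ 1`, no right pull has an advantage over a sure success. The set being nonempty,
`gittinsIndex` is a true infimum and not the default value of `sInf`. -/
lemma one_mem_gittinsIndex_set (hβ0 : 0 < β) (hβ1 : β < 1) :
    (1 : ℝ) ∈ {p : ℝ | p ∈ Set.Icc (0 : ℝ) 1 ∧ IsOptimalSingle μ β p alwaysLeft} := by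
  refine ⟨⟨zero_le_one, le_rfl⟩,
    isOptimal_alwaysLeft_of_singleGain_nonpos hβ0 hβ1 zero_le_one le_rfl fun S => ?_⟩
  exact integral_nonpos fun ω => mul_nonpos_of_nonpos_of_nonneg (by linarith [ω.1.2.2])
    (discountedSum_nonneg hβ0 _)

/-- Below the Gittins index some pure strategy that ignores the left arm's bits has a
positive gain. -/
lemma exists_singleGain_pos (hβ0 : 0 < β) (hβ1 : β < 1) (hp0 : 0 ≤ p)
    (hp : p < gittinsIndex μ β) : ∃ S, IgnoresLeft S ∧ 0 < singleGain μ β p p S := by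
  have hp1 : p ≤ 1 :=
    hp.le.trans (csInf_le gittinsIndex_set_bddBelow (one_mem_gittinsIndex_set hβ0 hβ1))
  have hn : ¬ IsOptimalSingle μ β p alwaysLeft := fun h =>
    absurd (csInf_le gittinsIndex_set_bddBelow ⟨⟨hp0, hp1⟩, h⟩) (not_le.2 hp)
  by_contra! hcon
  refine hn (isOptimal_alwaysLeft_of_singleGain_nonpos hβ0 hβ1 hp0 hp1 fun S => ?_)
  rw [singleGain_eq_integral_freeze hβ0 hβ1 hp0 hp1 p p]
  exact integral_nonpos fun u => hcon _ (ignoresLeft_freeze p S u)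

/-- Pull the right arm once, and keep pulling it exactly if the first pull succeeds. -/
def stayAfterFirstSuccess : SinglePure := fun t _ b =>
  if h : 0 < t then (if b ⟨0, h⟩ then Arm.R else Arm.L) else Arm.R

lemma riskyTime_stayAfterFirstSuccess (hβ0 : 0 < β) (hβ1 : β < 1) (ω : SingleNature) :
    riskyTime β (singleAction p stayAfterFirstSuccess ω)
      = 1 + β * (1 - β)⁻¹ * (if (ω.2 (0, Arm.R) : ℝ) < ω.1 then 1 else 0) := by
  have h0 : singleAction p stayAfterFirstSuccess ω 0 = Arm.R := by
    rw [singleAction]; simp [stayAfterFirstSuccess]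
  have h1 : ∀ t, singleAction p stayAfterFirstSuccess ω (t + 1)
      = if (ω.2 (0, Arm.R) : ℝ) < ω.1 then Arm.R else Arm.L := fun t => by
    rw [singleAction]
    simp [stayAfterFirstSuccess, h0, rewardBit, successProb]
  rw [riskyTime, discountedSum_succ hβ0 hβ1]
  by_cases h : (ω.2 (0, Arm.R) : ℝ) < ω.1
  · simp only [h0, h1, if_pos h, isRight, if_true, discountedSum_true hβ0 hβ1, mul_one]
  · simp only [h0, h1, if_neg h, isRight, if_true, discountedSum_false, mul_zero]

/-- The first pull contributes the mean of `θ - c`. With probability `θ` it succeeds, and then all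
later rounds contribute `(θ - c) * β / (1 - β)`. -/
lemma singleGain_stayAfterFirstSuccess (hβ0 : 0 < β) (hβ1 : β < 1) (c p : ℝ) :
    singleGain μ β c p stayAfterFirstSuccess
      = (∫ θ, (θ : ℝ) ∂μ - c) + β * (1 - β)⁻¹ *
        (∫ θ, (θ : ℝ) ^ 2 ∂μ - c * ∫ θ, (θ : ℝ) ∂μ) := by
  classical
  have hb : ∀ {f : unitInterval → ℝ}, Continuous f → ∃ C, ∀ θ, |f θ| ≤ C := fun hf => by
    obtain ⟨C, hC⟩ := isCompact_univ.exists_bound_of_continuousOn hf.continuousOn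
    exact ⟨C, fun θ => hC θ trivial⟩
  have hint : ∀ {f : unitInterval → ℝ}, Continuous f → Integrable f μ := fun hf => by
    obtain ⟨C, hC⟩ := hb hf
    exact Integrable.of_bound hf.measurable.aestronglyMeasurable C (Filter.Eventually.of_forall hC)
  have hfst : ∀ {f : unitInterval → ℝ}, Continuous f →
      ∫ ω, f ω.1 ∂(singleNatureLaw μ) = ∫ θ, f θ ∂μ := fun {f} hf => by
    have := integral_fun_fst (μ := μ) (ν := uniformLaw (ℕ × Arm)) f
    rwa [probReal_univ, one_smul] at this
  obtain ⟨C, hC⟩ := hb (f := fun θ => (θ : ℝ) - c) (by fun_prop)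
  have hbit := integral_mul_bit (μ := μ) (f := fun ω : SingleNature => (ω.1 : ℝ) - c)
    (by fun_prop) (fun ω => hC ω.1) (q := fun θ => θ) (by fun_prop) (fun θ => θ.2.1)
    (fun θ => θ.2.2) ((0, Arm.R) : ℕ × Arm) (fun _ _ _ => rfl)
  have hc1 : Continuous fun θ : unitInterval => (θ : ℝ) - c := by fun_prop
  have hc2 : Continuous fun θ : unitInterval => ((θ : ℝ) - c) * θ := by fun_prop
  have hi1 : Integrable (fun ω : SingleNature => (ω.1 : ℝ) - c) (singleNatureLaw μ) :=
    (hint hc1).comp_fst _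
  have hi2 : Integrable (fun ω : SingleNature =>
      ((ω.1 : ℝ) - c) * (if (ω.2 (0, Arm.R) : ℝ) < ω.1 then 1 else 0)) (singleNatureLaw μ) := by
    refine Integrable.mono hi1 ((hc1.measurable.comp measurable_fst).mul (Measurable.ite
      (measurableSet_lt (by fun_prop) (by fun_prop)) measurable_const
      measurable_const)).aestronglyMeasurable (Filter.Eventually.of_forall fun ω => ?_)
    rw [norm_mul]
    exact mul_le_of_le_one_right (norm_nonneg _) (by split_ifs <;> simp)
  unfold singleGain
  simp_rw [riskyTime_stayAfterFirstSuccess hβ0 hβ1]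
  have e : ∀ ω : SingleNature, ((ω.1 : ℝ) - c) *
      (1 + β * (1 - β)⁻¹ * (if (ω.2 (0, Arm.R) : ℝ) < ω.1 then 1 else 0))
      = ((ω.1 : ℝ) - c) + β * (1 - β)⁻¹ *
        (((ω.1 : ℝ) - c) * (if (ω.2 (0, Arm.R) : ℝ) < ω.1 then 1 else 0)) := fun ω => by ring
  simp_rw [e]
  rw [integral_add hi1 (hi2.const_mul _), integral_const_mul]
  unfold singleNatureLaw at *
  rw [hbit, hfst hc1, hfst hc2, integral_sub (hint (by fun_prop)) (integrable_const _)]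
  simp_rw [sub_mul]
  rw [integral_sub (hint (by fun_prop)) (hint (by fun_prop)), integral_const_mul]
  simp [pow_two]

/-- The value of information: wherever always playing left is optimal, the test strategy
`stayAfterFirstSuccess` has nonpositive gain, which keeps `c` away from the mean by at least `β`
times the variance. -/
lemma mean_add_le_gittinsIndex (hβ0 : 0 < β) (hβ1 : β < 1) :
    ∫ θ, (θ : ℝ) ∂μ + β * variance (fun x : unitInterval => (x : ℝ)) μ ≤ gittinsIndex μ β := by
  refine le_csInf ⟨1, one_mem_gittinsIndex_set hβ0 hβ1⟩ fun c hc => ?_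
  have h := singleGain_nonpos_of_isOptimal hβ0 hβ1 hc.1.1 hc.1.2 hc.2 stayAfterFirstSuccess
  rw [singleGain_stayAfterFirstSuccess hβ0 hβ1] at h
  have hmem : MemLp (fun x : unitInterval => (x : ℝ)) 2 μ :=
    MemLp.of_bound (by fun_prop) 1 (Filter.Eventually.of_forall fun x => by
      rw [Real.norm_eq_abs, abs_of_nonneg x.2.1]; exact x.2.2)
  have hvar := variance_eq_sub hmem
  have hw : 0 ≤ variance (fun x : unitInterval => (x : ℝ)) μ := variance_nonneg _ _
  have hm1 : ∫ θ : unitInterval, (θ : ℝ) ∂μ ≤ 1 := by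
    have := integral_mono (μ := μ) (hmem.integrable (by norm_num)) (integrable_const (1 : ℝ))
      (fun θ : unitInterval => θ.2.2)
    simpa using this
  have hm0 : 0 ≤ ∫ θ : unitInterval, (θ : ℝ) ∂μ := integral_nonneg fun θ => θ.2.1
  have hsq : ∫ θ : unitInterval, (θ : ℝ) ^ 2 ∂μ
      = variance (fun x : unitInterval => (x : ℝ)) μ + (∫ θ : unitInterval, (θ : ℝ) ∂μ) ^ 2 := by
    rw [hvar]; simp
  rw [hsq] at h
  set m := ∫ θ : unitInterval, (θ : ℝ) ∂μ
  set w := variance (fun x : unitInterval => (x : ℝ)) μ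
  have hb : 0 < 1 - β := by linarith
  have h2 : (m - c) * (1 - β) + β * (w + m ^ 2 - c * m) ≤ 0 := by
    have := mul_nonpos_of_nonpos_of_nonneg h hb.le
    field_simp at this
    linarith
  -- The second factor on the right lies in `(0, 1]`, so `c - m` is nonnegative and at least `β *
  -- w`.
  have h3 : β * w ≤ (c - m) * (1 - β + β * m) := by linarith
  have h4 : 0 < 1 - β + β * m := by positivity
  have h5 : 0 ≤ c - m := by
    by_contra! hneg
    have := mul_neg_of_neg_of_pos hneg h4
    nlinarith
  have h6 : 1 - β + β * m ≤ 1 := by nlinarith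
  linarith [mul_le_of_le_one_right h5 h6]

lemma variance_pos_of_ne_dirac (hμ : ∀ x : unitInterval, μ ≠ Measure.dirac x) :
    0 < variance (fun x : unitInterval => (x : ℝ)) μ := by
  refine (variance_nonneg _ _).lt_of_ne' fun h => ?_
  have hmem : MemLp (fun x : unitInterval => (x : ℝ)) 2 μ :=
    MemLp.of_bound (by fun_prop) 1 (Filter.Eventually.of_forall fun x => by
      rw [Real.norm_eq_abs, abs_of_nonneg x.2.1]; exact x.2.2)
  have hae := ae_eq_integral_of_variance_eq_zero hmem h
  -- A point where the identity equals its mean supplies the mean as an element of `unitInterval`.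
  obtain ⟨x, hx⟩ := hae.exists
  refine hμ x ?_
  have hae' : (fun y : unitInterval => y) =ᵐ[μ] fun _ => x := by
    filter_upwards [hae] with y hy
    exact Subtype.ext (hy.trans hx.symm)
  have hmap := Measure.map_congr (mβ := inferInstance) hae'
  simpa using hmap

lemma singleExploreProb_eq_zero (hβ0 : 0 < β) (hβ1 : β < 1) (hp1 : p ≤ 1)
    (hp : gittinsIndex μ β < p) {σ : ProbabilityMeasure SinglePure}
    (hσ : IsOptimalSingle μ β p σ) : singleExploreProb μ p σ = 0 := by
  obtain ⟨c, ⟨⟨hc0, hc1⟩, hopt⟩, hcp⟩ :=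
    exists_lt_of_csInf_lt ⟨1, one_mem_gittinsIndex_set hβ0 hβ1⟩ hp
  have hp0 : 0 ≤ p := hc0.trans hcp.le
  have hval := hσ alwaysLeft
  rw [singleValue_alwaysLeft hβ0 hβ1 hp0 hp1, singleValue_eq hβ0 hβ1 hp0 hp1] at hval
  -- The rewards are those at `p` while the advantage is measured against `c`. Freezing the left
  -- bits at `p` allows the strategy to be played at `c`, where optimality of always left applies.
  have hgain : ∀ S, singleGain μ β c p S ≤ 0 := fun S => by
    rw [singleGain_eq_integral_freeze hβ0 hβ1 hc0 hc1 p c]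
    exact integral_nonpos fun u => singleGain_nonpos_of_isOptimal hβ0 hβ1 hc0 hc1 hopt _
  have hc : ∫ x : SinglePure × SingleNature,
      ((x.2.1 : ℝ) - c) * riskyTime β (singleAction p x.1 x.2)
        ∂((σ : Measure SinglePure).prod (singleNatureLaw μ)) ≤ 0 := by
    rw [integral_prod _ (integrable_advantage_single hβ0 hβ1 hc0 hc1 p σ)]
    exact integral_nonpos hgain
  have hint : Integrable (fun x : SinglePure × SingleNature =>
      (p - c) * riskyTime β (singleAction p x.1 x.2))
        ((σ : Measure SinglePure).prod (singleNatureLaw μ)) :=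
    integrable_mul_riskyTime hβ0 hβ1 (C := |p - c|) measurable_const (fun x => le_rfl)
      (measurable_singleAction p)
  have hle : ∫ x : SinglePure × SingleNature, (p - c) * riskyTime β (singleAction p x.1 x.2)
      ∂((σ : Measure SinglePure).prod (singleNatureLaw μ)) ≤ 0 := by
    have h := integral_sub (integrable_advantage_single (μ := μ) hβ0 hβ1 hc0 hc1 p σ)
      (integrable_advantage_single (μ := μ) hβ0 hβ1 hp0 hp1 p σ)
    have e : ∀ x : SinglePure × SingleNature,
        ((x.2.1 : ℝ) - c) * riskyTime β (singleAction p x.1 x.2)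
          - ((x.2.1 : ℝ) - p) * riskyTime β (singleAction p x.1 x.2)
        = (p - c) * riskyTime β (singleAction p x.1 x.2) := fun x => by ring
    simp_rw [e] at h
    linarith
  have hnn : ∀ x : SinglePure × SingleNature,
      0 ≤ (p - c) * riskyTime β (singleAction p x.1 x.2) := fun x =>
    mul_nonneg (by linarith) (discountedSum_nonneg hβ0 _)
  have hz := (integral_eq_zero_iff_of_nonneg hnn hint).1 (le_antisymm hle (integral_nonneg hnn))
  refine measure_mono_null (fun x hx => ?_) (ae_iff.1 hz)
  obtain ⟨t, ht⟩ := hx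
  exact (mul_pos (by linarith : 0 < p - c)
    (discountedSum_pos hβ0 hβ1 (t := t) (isRight_eq_true.2 ht))).ne'

/-- A strategy that ignores the left arm's bits first pulls the right arm in a
deterministic round. -/
lemma IgnoresLeft.exists_first_right {S : SinglePure} (hS : IgnoresLeft S)
    (h : ∃ ω t, singleAction p S ω t = Arm.R) :
    ∃ k, ∀ ω q, (∀ t < k, singleAction q S ω t = Arm.L) ∧ singleAction q S ω k = Arm.R := by
  classical
  have h' : ∃ t, ∃ ω, singleAction p S ω t = Arm.R := by
    obtain ⟨ω, t, h⟩ := h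
    exact ⟨t, ω, h⟩
  refine ⟨Nat.find h', ?_⟩
  have hlt : ∀ ω q, ∀ t < Nat.find h', singleAction q S ω t = Arm.L := fun ω q t ht => by
    have := Nat.find_min h' ht
    rw [hS.singleAction_congr q p]
    cases hA : singleAction p S ω t
    · rfl
    · exact absurd ⟨ω, hA⟩ this
  refine fun ω q => ⟨hlt ω q, ?_⟩
  -- Before this round every realization has seen left pulls only. The histories then differ at most
  -- in ignored bits, so the arm is the same for all realizations.
  obtain ⟨ω', h0⟩ := Nat.find_spec h'
  refine Eq.trans ?_ h0
  have h1 : ∀ ω q, ∀ r : Fin (Nat.find h'), singleAction q S ω r = Arm.L := fun ω q r =>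
    hlt ω q r r.isLt
  rw [singleAction, singleAction]
  simp only [h1]
  exact hS _ _ _ _ fun s hs => by cases hs

end SingleOptimality
-- Two players: total rewards, and Bob copying Alice
section Game

lemma measurable_actions (p : ℝ) :
    Measurable fun x : PureStrategy × PureStrategy × Nature => actions p x.1 x.2.1 x.2.2 := by
  refine measurable_pi_lambda _ fun t => ?_
  induction t using Nat.strong_induction_on with
  | _ t ih =>
    simp only [actions.eq_1 p _ _ _ t]
    have hev : Measurable fun y : PureStrategy × (Fin t → Arm × Arm) × (Fin t → Bool) =>
        y.1 t y.2.1 y.2.2 := measurable_from_prod_countable_left fun z =>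
      (measurable_pi_apply z.2).comp ((measurable_pi_apply z.1).comp (measurable_pi_apply t))
    have hu : ∀ (s : ℕ) (i : Player),
        Measurable fun y : (ℕ × Player × Arm → unitInterval) × Arm => y.1 (s, i, y.2) :=
      fun s i => measurable_from_prod_countable_left fun a => measurable_pi_apply (s, i, a)
    have hh : Measurable fun x : PureStrategy × PureStrategy × Nature =>
        fun s : Fin t => actions p x.1 x.2.1 x.2.2 s :=
      measurable_pi_lambda _ fun s => ih s s.isLt
    have hω : Measurable fun x : PureStrategy × PureStrategy × Nature => x.2.2 := by fun_prop
    refine Measurable.prodMk ?_ ?_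
    · refine hev.comp (measurable_fst.prodMk (hh.prodMk (measurable_pi_lambda _ fun s => ?_)))
      have ha := (ih s s.isLt).fst
      exact (measurable_rewardBit p).comp <| hω.fst.prodMk
        (((hu s Player.alice).comp (hω.snd.prodMk ha)).prodMk ha)
    · refine hev.comp (measurable_snd.fst.prodMk (hh.prodMk (measurable_pi_lambda _ fun s => ?_)))
      have ha := (ih s s.isLt).snd
      exact (measurable_rewardBit p).comp <| hω.fst.prodMk
        (((hu s Player.bob).comp (hω.snd.prodMk ha)).prodMk ha)

lemma measurable_action (p : ℝ) (i : Player) :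
    Measurable fun x : PureStrategy × PureStrategy × Nature => action p x.1 x.2.1 x.2.2 i := by
  refine measurable_pi_lambda _ fun t => ?_
  have h := (measurable_pi_apply t).comp (measurable_actions p)
  cases i
  · exact h.fst
  · exact h.snd

lemma actions_update (p : ℝ) (SA SB : PureStrategy) (θ : unitInterval)
    (u : ℕ × Player × Arm → unitInterval) (s : ℕ) (i : Player) (x : Arm) (y : unitInterval)
    [DecidableEq (ℕ × Player × Arm)] {t : ℕ} (ht : t ≤ s) :
    actions p SA SB (θ, Function.update u (s, i, x) y) t = actions p SA SB (θ, u) t := by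
  induction t using Nat.strong_induction_on with
  | _ t ih =>
    have h1 : ∀ r : Fin t, actions p SA SB (θ, Function.update u (s, i, x) y) r
        = actions p SA SB (θ, u) r := fun r => ih r r.isLt (by omega)
    have h2 : ∀ (r : Fin t) (k : Player) (a : Arm),
        Function.update u (s, i, x) y ((r : ℕ), k, a) = u (r, k, a) := fun r k a =>
      Function.update_of_ne (by simp only [ne_eq, Prod.mk.injEq]; omega) _ _
    rw [actions, actions]
    simp only [h1, h2]

variable {μ : Measure unitInterval} [IsProbabilityMeasure μ] {β p : ℝ}

instance : IsProbabilityMeasure (natureLaw μ) := by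
  unfold natureLaw; infer_instance

instance (σA σB : MixedStrategy) : IsProbabilityMeasure (gameLaw μ σA σB) := by
  unfold gameLaw; infer_instance

lemma integral_totalReward (hβ0 : 0 < β) (hβ1 : β < 1) (hp0 : 0 ≤ p) (hp1 : p ≤ 1)
    (SA SB : PureStrategy) (i : Player) :
    ∫ ω, totalReward β p SA SB ω i ∂(natureLaw μ)
      = p * (1 - β)⁻¹ +
        ∫ ω, ((ω.1 : ℝ) - p) * riskyTime β (action p SA SB ω i) ∂(natureLaw μ) := by
  classical
  refine integral_discounted_reward hβ0 hβ1 hp0 hp1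
    ((measurable_action p i).comp (f := fun ω : Nature => (SA, SB, ω)) (by fun_prop))
    (fun t a => (t, i, a)) fun t x θ u y => ?_
  have h := actions_update p SA SB θ u t i x y le_rfl
  cases i <;> simp [action, h]

lemma integral_gameLaw (σA σB : MixedStrategy) {f : PureStrategy × PureStrategy × Nature → ℝ}
    (hf : Integrable f (gameLaw μ σA σB)) :
    ∫ x, f x ∂(gameLaw μ σA σB)
      = ∫ S : PureStrategy × PureStrategy, ∫ ω, f (S.1, S.2, ω) ∂(natureLaw μ)
        ∂((σA : Measure PureStrategy).prod (σB : Measure PureStrategy)) := by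
  have hmp : MeasurePreserving
      (fun x : (PureStrategy × PureStrategy) × Nature => (x.1.1, x.1.2, x.2))
      (((σA : Measure PureStrategy).prod (σB : Measure PureStrategy)).prod (natureLaw μ))
      (gameLaw μ σA σB) := measurePreserving_prodAssoc _ _ _
  rw [← hmp.map_eq, integral_map hmp.measurable.aemeasurable
    (by rw [hmp.map_eq]; exact hf.aestronglyMeasurable), integral_prod]
  exact (hmp.integrable_comp hf.aestronglyMeasurable).2 hf

lemma integrable_totalReward (hβ0 : 0 < β) (hβ1 : β < 1) (p : ℝ) (σA σB : MixedStrategy)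
    (i : Player) :
    Integrable (fun x : PureStrategy × PureStrategy × Nature => totalReward β p x.1 x.2.1 x.2.2 i)
      (gameLaw μ σA σB) :=
  integrable_discountedSum hβ0 hβ1
    (measurable_rewards p (measurable_action p i) (by fun_prop) fun t a => (t, i, a))

lemma integrable_advantage (hβ0 : 0 < β) (hβ1 : β < 1) (hp0 : 0 ≤ p) (hp1 : p ≤ 1)
    (σA σB : MixedStrategy) (i : Player) :
    Integrable (fun x : PureStrategy × PureStrategy × Nature =>
      ((x.2.2.1 : ℝ) - p) * riskyTime β (action p x.1 x.2.1 x.2.2 i)) (gameLaw μ σA σB) :=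
  integrable_mul_riskyTime hβ0 hβ1 (by fun_prop) (fun x => abs_sub_le_one x.2.2.1 hp0 hp1)
    (measurable_action p i)

lemma integral_gameLaw_totalReward (hβ0 : 0 < β) (hβ1 : β < 1) (hp0 : 0 ≤ p) (hp1 : p ≤ 1)
    (σA σB : MixedStrategy) (i : Player) :
    ∫ x : PureStrategy × PureStrategy × Nature, totalReward β p x.1 x.2.1 x.2.2 i
        ∂(gameLaw μ σA σB)
      = p * (1 - β)⁻¹ + ∫ x : PureStrategy × PureStrategy × Nature,
        ((x.2.2.1 : ℝ) - p) * riskyTime β (action p x.1 x.2.1 x.2.2 i) ∂(gameLaw μ σA σB) := by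
  have hint := integrable_advantage (μ := μ) hβ0 hβ1 hp0 hp1 σA σB i
  have hadd := integral_add (integrable_const (μ := gameLaw μ σA σB) (p * (1 - β)⁻¹)) hint
  rw [integral_const, probReal_univ, one_smul] at hadd
  have hsum : Integrable (fun x : PureStrategy × PureStrategy × Nature => p * (1 - β)⁻¹ +
      ((x.2.2.1 : ℝ) - p) * riskyTime β (action p x.1 x.2.1 x.2.2 i)) (gameLaw μ σA σB) :=
    (integrable_const _).add hint
  rw [← hadd, integral_gameLaw σA σB (integrable_totalReward hβ0 hβ1 p σA σB i),
    integral_gameLaw σA σB hsum]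
  congr 1
  ext S
  rw [integral_totalReward hβ0 hβ1 hp0 hp1, integral_add (integrable_const _)]
  · simp
  · exact integrable_mul_riskyTime (P := natureLaw μ) hβ0 hβ1 (f := fun ω => (ω.1 : ℝ) - p)
      (by fun_prop) (fun ω => abs_sub_le_one ω.1 hp0 hp1)
      ((measurable_action p i).comp (f := fun ω : Nature => (S.1, S.2, ω)) (by fun_prop))

lemma expectedUtility_eq (hβ0 : 0 < β) (hβ1 : β < 1) (hp0 : 0 ≤ p) (hp1 : p ≤ 1)
    (σA σB : MixedStrategy) (i : Player) :
    expectedUtility μ 1 β p σA σB i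
      = 2 * p * (1 - β)⁻¹ + (∫ x : PureStrategy × PureStrategy × Nature,
          ((x.2.2.1 : ℝ) - p) * riskyTime β (action p x.1 x.2.1 x.2.2 Player.alice)
            ∂(gameLaw μ σA σB)
        + ∫ x : PureStrategy × PureStrategy × Nature,
          ((x.2.2.1 : ℝ) - p) * riskyTime β (action p x.1 x.2.1 x.2.2 Player.bob)
            ∂(gameLaw μ σA σB)) := by
  have hA := integral_gameLaw_totalReward (μ := μ) hβ0 hβ1 hp0 hp1 σA σB Player.alice
  have hB := integral_gameLaw_totalReward (μ := μ) hβ0 hβ1 hp0 hp1 σA σB Player.bob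
  have hiA := integrable_totalReward (μ := μ) hβ0 hβ1 p σA σB Player.alice
  have hiB := integrable_totalReward (μ := μ) hβ0 hβ1 p σA σB Player.bob
  unfold expectedUtility
  cases i
  · simp only [utility, one_mul]
    rw [integral_add hiA hiB, hA, hB]
    ring
  · simp only [utility, one_mul]
    rw [integral_add hiB hiA, hA, hB]
    ring

lemma integral_advantage_eq_zero {μ : Measure unitInterval} {σA σB : MixedStrategy} {i : Player}
    (h : exploreProb μ p σA σB i = 0) :
    ∫ x : PureStrategy × PureStrategy × Nature,
      ((x.2.2.1 : ℝ) - p) * riskyTime β (action p x.1 x.2.1 x.2.2 i) ∂(gameLaw μ σA σB) = 0 := by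
  refine integral_eq_zero_of_ae ?_
  have hae : ∀ᵐ x ∂(gameLaw μ σA σB), ¬ ∃ t, action p x.1 x.2.1 x.2.2 i t = Arm.R :=
    measure_eq_zero_iff_ae_notMem.1 h
  filter_upwards [hae] with x hx
  rw [riskyTime_eq_zero_of_forall fun t => ?_]
  · simp
  · cases hA : action p x.1 x.2.1 x.2.2 i t
    · rfl
    · exact absurd ⟨t, hA⟩ hx

/-- The mixed strategy that plays a pure strategy surely. -/
noncomputable def pureMixed (S : PureStrategy) : MixedStrategy :=
  ⟨Measure.dirac S, inferInstance⟩

lemma integral_gameLaw_pure (SA SB : PureStrategy)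
    {f : PureStrategy × PureStrategy × Nature → ℝ} (hf : Measurable f) :
    ∫ x, f x ∂(gameLaw μ (pureMixed SA) (pureMixed SB))
      = ∫ ω, f (SA, SB, ω) ∂(natureLaw μ) := by
  change ∫ x, f x ∂((Measure.dirac SA).prod ((Measure.dirac SB).prod (natureLaw μ))) = _
  rw [Measure.dirac_prod, integral_map measurable_prodMk_left.aemeasurable
    hf.aestronglyMeasurable, Measure.dirac_prod,
    integral_map (f := fun x => f (SA, x)) measurable_prodMk_left.aemeasurable
      (hf.comp measurable_prodMk_left).aestronglyMeasurable]

/-- Play a strategy of the single player, disregarding the other player. -/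
def playAlone (S : SinglePure) : PureStrategy := fun t h b => S t (fun s => (h s).1) b

/-- From round `K` on, repeat Alice's arm of the previous round; before that, play left. -/
def copyAlice (K : ℕ) : PureStrategy := fun t h _ =>
  if ht : 0 < t ∧ K ≤ t then (h ⟨t - 1, by omega⟩).1 else Arm.L

/-- The part of Nature's randomness that concerns Alice. -/
def aliceNature (ω : Nature) : SingleNature := (ω.1, fun x => ω.2 (x.1, Player.alice, x.2))

lemma measurePreserving_aliceNature :
    MeasurePreserving aliceNature (natureLaw μ) (singleNatureLaw μ) := by
  have hinj : Function.Injective fun x : ℕ × Arm => (x.1, Player.alice, x.2) := by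
    rintro ⟨a, b⟩ ⟨c, d⟩ h
    simpa using h
  exact (MeasurePreserving.id μ).prod (measurePreserving_comp_injective hinj)

/-- Alice disregards Bob's arms and sees only her own bits, so her play is a single-player game
driven by her share of the randomness. -/
lemma action_alice_playAlone (S : SinglePure) (SB : PureStrategy) (ω : Nature) (t : ℕ) :
    action p (playAlone S) SB ω Player.alice t = singleAction p S (aliceNature ω) t := by
  induction t using Nat.strong_induction_on with
  | _ t ih =>
    have h : ∀ r : Fin t, (actions p (playAlone S) SB ω r).1
        = singleAction p S (aliceNature ω) r := fun r => ih r r.isLt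
    rw [singleAction]
    simp only [action]
    rw [actions]
    simp only [playAlone] at h ⊢
    simp only [h]
    rfl

lemma action_bob_copyAlice (SA : PureStrategy) (K : ℕ) (ω : Nature) (t : ℕ) :
    action p SA (copyAlice K) ω Player.bob t
      = if 0 < t ∧ K ≤ t then action p SA (copyAlice K) ω Player.alice (t - 1) else Arm.L := by
  simp only [action]
  rw [actions]
  simp only [copyAlice]
  split_ifs <;> rfl

lemma riskyTime_copyAlice_zero (hβ0 : 0 < β) (hβ1 : β < 1) (SA : PureStrategy) (ω : Nature) :
    riskyTime β (action p SA (copyAlice 0) ω Player.bob)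
      = β * riskyTime β (action p SA (copyAlice 0) ω Player.alice) := by
  rw [riskyTime, discountedSum_succ hβ0 hβ1]
  simp [action_bob_copyAlice _ _ ω (_ + 1), action_bob_copyAlice _ _ ω 0, isRight, riskyTime]

/-- Bob would copy Alice's pull of round `k` in round `k + 1`. Starting at `k + 2` drops exactly
that copy, as her earlier arms are all left. -/
lemma riskyTime_copyAlice_skip (hβ0 : 0 < β) (hβ1 : β < 1) (SA : PureStrategy) (ω : Nature)
    {k : ℕ} (hlt : ∀ t < k, action p SA (copyAlice (k + 2)) ω Player.alice t = Arm.L)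
    (hk : action p SA (copyAlice (k + 2)) ω Player.alice k = Arm.R) :
    riskyTime β (action p SA (copyAlice (k + 2)) ω Player.bob)
      = β * riskyTime β (action p SA (copyAlice (k + 2)) ω Player.alice) - β ^ (k + 1) := by
  have hA : riskyTime β (action p SA (copyAlice (k + 2)) ω Player.alice) = β ^ k * (1 + β *
      discountedSum β fun t =>
        isRight (action p SA (copyAlice (k + 2)) ω Player.alice (t + 1 + k))) := by
    rw [riskyTime, discountedSum_shift hβ0 hβ1 (k := k) fun t ht => by rw [hlt t ht]; rfl,
      discountedSum_succ hβ0 hβ1]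
    simp [hk, isRight]
  have hB : riskyTime β (action p SA (copyAlice (k + 2)) ω Player.bob) = β ^ (k + 2) *
      discountedSum β fun t =>
        isRight (action p SA (copyAlice (k + 2)) ω Player.alice (t + 1 + k)) := by
    rw [riskyTime, discountedSum_shift hβ0 hβ1 (k := k + 2) fun t ht => by
      rw [action_bob_copyAlice, if_neg (by omega)]; rfl]
    congr 2
    ext t
    rw [action_bob_copyAlice, if_pos (by omega)]
    congr 2
    omega
  rw [hA, hB]
  ring

end Game
-- Cooperation: a pair with positive total gain
section Cooperation

variable {μ : Measure unitInterval} [IsProbabilityMeasure μ] {β p : ℝ}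

/-- Without exploration the pair earns exactly `2 * p / (1 - β)`, so optimality bounds the summed
gains of every pure pair by zero. -/
lemma advantage_nonpos_of_isOptimalPair (hβ0 : 0 < β) (hβ1 : β < 1) (hp0 : 0 ≤ p) (hp1 : p ≤ 1)
    {σA σB : MixedStrategy} (hopt : IsOptimalPair μ β p σA σB)
    (hexp : ∀ i, exploreProb μ p σA σB i = 0) (SA SB : PureStrategy) :
    ∫ ω, ((ω.1 : ℝ) - p) * riskyTime β (action p SA SB ω Player.alice) ∂(natureLaw μ)
      + ∫ ω, ((ω.1 : ℝ) - p) * riskyTime β (action p SA SB ω Player.bob) ∂(natureLaw μ) ≤ 0 := by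
  have h := hopt (pureMixed SA) (pureMixed SB) Player.alice
  have hm : ∀ i, Measurable fun x : PureStrategy × PureStrategy × Nature =>
      ((x.2.2.1 : ℝ) - p) * riskyTime β (action p x.1 x.2.1 x.2.2 i) := fun i => by
    have := (measurable_riskyTime hβ0 hβ1).comp (measurable_action p i)
    simp only [Function.comp_def] at this
    fun_prop
  rw [expectedUtility_eq hβ0 hβ1 hp0 hp1, expectedUtility_eq hβ0 hβ1 hp0 hp1,
    integral_advantage_eq_zero (hexp _), integral_advantage_eq_zero (hexp _),
    integral_gameLaw_pure _ _ (hm _), integral_gameLaw_pure _ _ (hm _)] at h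
  linarith

lemma integral_advantage_playAlone (hβ0 : 0 < β) (hβ1 : β < 1) (S : SinglePure)
    (SB : PureStrategy) :
    ∫ ω, ((ω.1 : ℝ) - p) * riskyTime β (action p (playAlone S) SB ω Player.alice) ∂(natureLaw μ)
      = singleGain μ β p p S := by
  have hm : Measurable fun ω : SingleNature =>
      ((ω.1 : ℝ) - p) * riskyTime β (singleAction p S ω) :=
    (measurable_advantage_single hβ0 hβ1 p p).comp measurable_prodMk_left
  have hmp := measurePreserving_aliceNature (μ := μ)
  unfold singleGain
  rw [← hmp.map_eq, integral_map hmp.measurable.aemeasurable hm.aestronglyMeasurable]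
  refine integral_congr_ae (Filter.Eventually.of_forall fun ω => ?_)
  have : action p (playAlone S) SB ω Player.alice = singleAction p S (aliceNature ω) :=
    funext fun t => action_alice_playAlone S SB ω t
  simp only [this]
  rfl

lemma riskyTime_le_of_forall_lt (hβ0 : 0 < β) (hβ1 : β < 1) {A : ℕ → Arm} {k : ℕ}
    (h : ∀ t < k, A t = Arm.L) : riskyTime β A ≤ β ^ k * (1 - β)⁻¹ := by
  rw [riskyTime, discountedSum_shift hβ0 hβ1 (k := k) fun t ht => by rw [h t ht]; rfl]
  exact mul_le_mul_of_nonneg_left (discountedSum_le hβ0 hβ1 _) (pow_nonneg hβ0.le k)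

/-- Changing the success probability of the safe arm costs at most the difference for each
discounted pull of the risky arm. -/
lemma singleGain_ge_of_ignoresLeft (hβ0 : 0 < β) (hβ1 : β < 1) {c : ℝ} (hc0 : 0 ≤ c) (hcp : c ≤ p)
    (hp1 : p ≤ 1) {S : SinglePure} (hS : IgnoresLeft S) {k : ℕ}
    (hk : ∀ ω, ∀ t < k, singleAction p S ω t = Arm.L) :
    singleGain μ β c c S - (p - c) * (β ^ k * (1 - β)⁻¹) ≤ singleGain μ β p p S := by
  have hact : singleAction c S = singleAction p S := by
    ext ω t
    exact hS.singleAction_congr c p ω t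
  have hi : ∀ q, 0 ≤ q → q ≤ 1 → Integrable (fun ω : SingleNature =>
      ((ω.1 : ℝ) - q) * riskyTime β (singleAction p S ω)) (singleNatureLaw μ) := fun q h0 h1 =>
    integrable_mul_riskyTime hβ0 hβ1 (by fun_prop) (fun x => abs_sub_le_one x.1 h0 h1)
      (measurable_singleAction_right p S)
  unfold singleGain
  rw [hact, sub_le_iff_le_add, ← sub_le_iff_le_add', ← integral_sub (hi c hc0 (hcp.trans hp1))
    (hi p (hc0.trans hcp) hp1)]
  have hle := integral_mono (μ := singleNatureLaw μ) ((hi c hc0 (hcp.trans hp1)).sub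
    (hi p (hc0.trans hcp) hp1)) (integrable_const ((p - c) * (β ^ k * (1 - β)⁻¹))) fun ω => by
      have := mul_le_mul_of_nonneg_left (riskyTime_le_of_forall_lt hβ0 hβ1 (hk ω))
        (sub_nonneg.2 hcp)
      simp only [Pi.sub_apply]
      linarith
  simpa using hle

/-- The omitted pull sits in a deterministic round, hence its weight is constant and only the mean
of `θ - p` enters. -/
lemma integral_advantage_copyAlice (hβ0 : 0 < β) (hβ1 : β < 1) (hp0 : 0 ≤ p) (hp1 : p ≤ 1)
    {S : SinglePure} {k : ℕ}
    (hk : ∀ ω, (∀ t < k, singleAction p S ω t = Arm.L) ∧ singleAction p S ω k = Arm.R) :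
    ∫ ω, ((ω.1 : ℝ) - p) *
        riskyTime β (action p (playAlone S) (copyAlice (k + 2)) ω Player.bob) ∂(natureLaw μ)
      = β * singleGain μ β p p S + β ^ (k + 1) * (p - ∫ θ, (θ : ℝ) ∂μ) := by
  have hbob : ∀ ω, ((ω.1 : ℝ) - p) *
      riskyTime β (action p (playAlone S) (copyAlice (k + 2)) ω Player.bob)
      = β * (((ω.1 : ℝ) - p) *
        riskyTime β (action p (playAlone S) (copyAlice (k + 2)) ω Player.alice))
        - β ^ (k + 1) * ((ω.1 : ℝ) - p) := fun ω => by
    rw [riskyTime_copyAlice_skip hβ0 hβ1 (playAlone S) ω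
      (fun t ht => (action_alice_playAlone S _ ω t).trans ((hk _).1 t ht))
      ((action_alice_playAlone S _ ω k).trans (hk _).2)]
    ring
  have hi : Integrable (fun ω : Nature => ((ω.1 : ℝ) - p) *
      riskyTime β (action p (playAlone S) (copyAlice (k + 2)) ω Player.alice)) (natureLaw μ) :=
    integrable_mul_riskyTime hβ0 hβ1 (by fun_prop) (fun x => abs_sub_le_one x.1 hp0 hp1)
      ((measurable_action p Player.alice).comp
        (f := fun ω : Nature => (playAlone S, copyAlice (k + 2), ω)) (by fun_prop))
  have hθ : Integrable (fun θ : unitInterval => (θ : ℝ)) μ :=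
    Integrable.of_bound (by fun_prop) 1 (Filter.Eventually.of_forall fun x => by
      rw [Real.norm_eq_abs, abs_of_nonneg x.2.1]; exact x.2.2)
  have hi' : Integrable (fun ω : Nature => (ω.1 : ℝ) - p) (natureLaw μ) :=
    (hθ.sub (integrable_const p)).comp_fst _
  have hmean : ∫ ω : Nature, ((ω.1 : ℝ) - p) ∂(natureLaw μ) = ∫ θ, (θ : ℝ) ∂μ - p := by
    have := integral_fun_fst (μ := μ) (ν := uniformLaw (ℕ × Player × Arm))
      fun θ : unitInterval => (θ : ℝ) - p
    rw [probReal_univ, one_smul, integral_sub hθ (integrable_const p), integral_const,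
      probReal_univ, one_smul] at this
    exact this
  simp_rw [hbob]
  rw [integral_sub (hi.const_mul _) (hi'.const_mul _), integral_const_mul, integral_const_mul,
    integral_advantage_playAlone hβ0 hβ1, hmean]
  ring

lemma exists_exploreProb_pos (hβ0 : 0 < β) (hβ1 : β < 1)
    (hμ : ∀ x : unitInterval, μ ≠ Measure.dirac x) (hp0 : 0 ≤ p) (hp1 : p ≤ 1)
    (hp : p < gittinsIndex μ β
      + β ^ 2 * variance (fun x : unitInterval => (x : ℝ)) μ * (1 - β) / 4)
    {σA σB : MixedStrategy} (hopt : IsOptimalPair μ β p σA σB) :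
    ∃ i, 0 < exploreProb μ p σA σB i := by
  by_contra! hcon
  have hteam := advantage_nonpos_of_isOptimalPair hβ0 hβ1 hp0 hp1 hopt
    fun i => nonpos_iff_eq_zero.1 (hcon i)
  rcases lt_or_ge p (gittinsIndex μ β) with hpg | hgp
  · obtain ⟨S, -, hS⟩ := exists_singleGain_pos hβ0 hβ1 hp0 hpg
    have h := hteam (playAlone S) (copyAlice 0)
    simp_rw [riskyTime_copyAlice_zero hβ0 hβ1, mul_left_comm _ β] at h
    rw [integral_const_mul, integral_advantage_playAlone hβ0 hβ1] at h
    nlinarith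
  have hw := variance_pos_of_ne_dirac hμ
  have hmg := mean_add_le_gittinsIndex (μ := μ) hβ0 hβ1
  have hm0 : 0 ≤ ∫ θ : unitInterval, (θ : ℝ) ∂μ := integral_nonneg fun θ => θ.2.1
  set w := variance (fun x : unitInterval => (x : ℝ)) μ
  have hg0 : 0 < gittinsIndex μ β := by nlinarith
  -- Here `c` is positive, below the index, and within `β ^ 2 * w * (1 - β) / 4` of `p`; the factor
  -- `1 - β` cancels the bound `β ^ k / (1 - β)` on the discounted right pulls.
  obtain ⟨c, hc, hcg⟩ := exists_between
    (max_lt hg0 (by linarith : p - β ^ 2 * w * (1 - β) / 4 < gittinsIndex μ β))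
  obtain ⟨hc0, hcp⟩ := max_lt_iff.1 hc
  obtain ⟨S, hS, hpos⟩ := exists_singleGain_pos hβ0 hβ1 hc0.le hcg
  have hex : ∃ ω t, singleAction c S ω t = Arm.R := by
    by_contra! hL
    have : ∀ ω, riskyTime β (singleAction c S ω) = 0 := fun ω =>
      riskyTime_eq_zero_of_forall fun t => by
        cases hA : singleAction c S ω t
        · rfl
        · exact absurd hA (hL ω t)
    simp [singleGain, this] at hpos
  obtain ⟨k, hk⟩ := hS.exists_first_right hex
  have hA := singleGain_ge_of_ignoresLeft (μ := μ) hβ0 hβ1 hc0.le (hcg.le.trans hgp) hp1 hS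
    fun ω => (hk ω p).1
  have h := hteam (playAlone S) (copyAlice (k + 2))
  rw [integral_advantage_playAlone hβ0 hβ1,
    integral_advantage_copyAlice hβ0 hβ1 hp0 hp1 fun ω => hk ω p] at h
  have hb : 0 < 1 - β := by linarith
  have hBk : 0 < β ^ k := pow_pos hβ0 k
  have hloss : (p - c) * (β ^ k * (1 - β)⁻¹) ≤ β ^ k * (β ^ 2 * w / 4) := by
    have h1 : (p - c) * (1 - β)⁻¹ ≤ β ^ 2 * w / 4 := by
      rw [← div_eq_mul_inv, div_le_iff₀ hb]
      linarith
    have := mul_le_mul_of_nonneg_left h1 hBk.le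
    linarith
  have hgain : -(β ^ k * (β ^ 2 * w / 4)) < singleGain μ β p p S := by linarith
  -- Bob's saving from the omitted pull, by `p ≥ g ≥ m + β * w`.
  have hmean : β ^ k * (β ^ 2 * w) ≤ β ^ (k + 1) * (p - ∫ θ, (θ : ℝ) ∂μ) := by
    have h1 : β * w ≤ p - ∫ θ : unitInterval, (θ : ℝ) ∂μ := by linarith
    calc β ^ k * (β ^ 2 * w) = β ^ (k + 1) * (β * w) := by ring
      _ ≤ _ := mul_le_mul_of_nonneg_left h1 (pow_pos hβ0 (k + 1)).le
  have hX : 0 < β ^ k * (β ^ 2 * w) := by positivity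
  have hsum : -((1 + β) * (β ^ k * (β ^ 2 * w / 4))) < (1 + β) * singleGain μ β p p S := by
    have := mul_lt_mul_of_pos_left hgain (by linarith : 0 < 1 + β)
    linarith
  -- With `X = β ^ k * (β ^ 2 * w)`, the summed gains exceed `X - (1 + β) * X / 4`, which is
  -- positive as `β < 1`.
  nlinarith

end Cooperation

end Bandit

theorem theorem3 (β : ℝ) (hβ0 : 0 < β) (hβ1 : β < 1)
    (μ : MeasureTheory.Measure unitInterval) [MeasureTheory.IsProbabilityMeasure μ]
    (hμ : ∀ x : unitInterval, μ ≠ MeasureTheory.Measure.dirac x) :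
    ∃ phat : ℝ,
      phat = Bandit.gittinsIndex μ β
        + β ^ 2 * ProbabilityTheory.variance (fun x : unitInterval => (x : ℝ)) μ * (1 - β) / 4 ∧
      Bandit.gittinsIndex μ β < phat ∧
      (∀ p : ℝ, 0 ≤ p → p ≤ 1 → p < phat →
        ∀ σA σB : Bandit.MixedStrategy, Bandit.IsOptimalPair μ β p σA σB →
          ∃ i : Bandit.Player, 0 < Bandit.exploreProb μ p σA σB i) ∧
      (∀ p : ℝ, p ≤ 1 → Bandit.gittinsIndex μ β < p →
        ∀ σ : MeasureTheory.ProbabilityMeasure Bandit.SinglePure, Bandit.IsOptimalSingle μ β p σ →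
          Bandit.singleExploreProb μ p σ = 0) := by
  have hw := Bandit.variance_pos_of_ne_dirac hμ
  refine ⟨_, rfl, ?_, fun p hp0 hp1 hp σA σB hopt =>
    Bandit.exists_exploreProb_pos hβ0 hβ1 hμ hp0 hp1 hp hopt,
    fun p hp1 hp σ hσ => Bandit.singleExploreProb_eq_zero hβ0 hβ1 hp1 hp hσ⟩
  have h1 : 0 < 1 - β := by linarith
  have h2 : 0 < β ^ 2 * ProbabilityTheory.variance (fun x : unitInterval => (x : ℝ)) μ
    * (1 - β) / 4 := by positivity
  linarith
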